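/- Let $P(z)=z^2-\lambda$ with $\lambda>2+\sqrt2$, and let $E_0=\mathbb C\setminus\{z: P^{\circ n}(z)\to\infty\}$ be its Julia set; it is real, $E_0\subset\mathbb R$. Let $g$ be the Green's function of $\Omega=\overline{\mathbb C}\setminus E_0$ with pole at $\infty$ (positive and harmonic on $\mathbb C\setminus E_0$, with boundary values $0$ on $E_0$, and such that $g(z)-\log|z|$ has a finite limit as $z\to\infty$). Let $\tilde\Omega=\overline{\mathbb C}\setminus\operatorname{conv}(E_0)$ and let $T:H\to\tilde\Omega$ be the Green's mapping of $\Omega$: the conformal bijection from a domain $H\ni 0$ of the unit disc onto $\tilde\Omega$ with $g(T(w))=-\log|w|$, $T(0)=\infty$ and $\lim_{w\to0}wT(w)>0$. (Such $T$ and $H$ exist; they are unique, and $T$ has a simple pole at $0$.) For $N\in\{1,2,\dots\}$ let $F_N$ be the set of all $\psi=\sum_{k\ge1}\varepsilon_k2^{-k}$, $\varepsilon_k\in\{0,1\}$, such that for every $k\ge1$ the equalities $\varepsilon_k=\varepsilon_{k+1}=\dots=\varepsilon_{k+N}$ imply $\varepsilon_{k+N+1}\neq\varepsilon_{k+N}$.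 Then for every $N\ge1$ and every $r_0\in(0,1)$ there is $C_{N,r_0}<\infty$ such that for every $\psi\in F_N$ the radius $\{re^{-i\pi\psi}:0<r<1\}$ lies in $H$ and $$\int_{r_0}^1|T''(re^{-i\pi\psi})|\,dr\le C_{N,r_0}.$$ Moreover, there is $c>0$, independent of $N$, such that $\operatorname{Hdim}(F_N)>1-c/N$ for all $N\ge1$; and $\operatorname{Hdim}\big(\bigcup_{N\ge1}F_N\big)=1$. -/

import Mathlib

open Filter Topology Bornology

/-- The set `E₀` attached to the quadratic polynomial `P(z) = z² - lam`: the complement of the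
basin of attraction of infinity. (For `lam > 2` it is the Julia set of `P`.) -/
def juliaSet (lam : ℝ) : Set ℂ :=
  {z : ℂ | ¬ Tendsto (fun n : ℕ => (fun w : ℂ => w ^ 2 - (lam : ℂ))^[n] z) atTop (cobounded ℂ)}

/-- `g` is the Green's function, with pole at infinity, of the domain `Ω = Ĉ ∖ E`, where `E` is a
compact set all of whose boundary points are regular: `g` is positive and harmonic on `ℂ ∖ E`,
it vanishes at the boundary, and `g(z) = log |z| + γ + o(1)` at infinity. -/
structure IsGreenFunction (E : Set ℂ) (g : ℂ → ℝ) : Prop where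
  harmonic : InnerProductSpace.HarmonicOnNhd g Eᶜ
  pos : ∀ z ∈ Eᶜ, 0 < g z
  boundary : ∀ ζ ∈ frontier E, Tendsto g (𝓝[Eᶜ] ζ) (𝓝 0)
  infinity : ∃ γ : ℝ, Tendsto (fun z : ℂ => g z - Real.log ‖z‖) (cobounded ℂ) (𝓝 γ)

/-- For a compact set `E ⊆ ℝ`, the set `H` is the Green's fundamental domain and
`T : H → Ω̃ = Ĉ ∖ conv(E)` is the Green's mapping of `Ω = Ĉ ∖ E` with base point infinity:
the inverse of the (single-valued, injective) branch on `Ĉ ∖ conv(E)` of the complex Green's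
function `G`, `- log |G(z)| = g(z, ∞)`, which is positive near `+∞`. The point `0` of `H` is
mapped to infinity, so that `T` has a simple pole there; the value of the Lean function `T`
at `0` is irrelevant. -/
structure IsGreenMapping (E : Set ℂ) (H : Set ℂ) (T : ℂ → ℂ) : Prop where
  isOpen : IsOpen H
  zero_mem : (0 : ℂ) ∈ H
  bijOn : Set.BijOn T (H \ {0}) (convexHull ℝ E)ᶜ
  holomorphic : DifferentiableOn ℂ T (H \ {0})
  green : ∃ g : ℂ → ℝ, IsGreenFunction E g ∧ ∀ w ∈ H \ {0}, g (T w) = - Real.log ‖w‖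
  pole : ∃ c : ℝ, 0 < c ∧ Tendsto (fun w : ℂ => w * T w) (𝓝[≠] 0) (𝓝 (c : ℂ))

/-- The set `F_N` of all `ψ = ∑_{k ≥ 1} ε_k 2^{-k}`, `ε_k ∈ {0, 1}`, such that whenever
`ε_k = ε_{k+1} = ⋯ = ε_{k+N}`, then `ε_{k+N+1} ≠ ε_{k+N}`.
(The digit `ε_{k+1}` is `ε k` in the code.) -/
def boundedRunSet (N : ℕ) : Set ℝ :=
  {ψ : ℝ | ∃ ε : ℕ → Fin 2,
    HasSum (fun k : ℕ => ((ε k : ℕ) : ℝ) / 2 ^ (k + 1)) ψ ∧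
    ∀ k : ℕ, (∀ j ≤ N, ε (k + j) = ε k) → ε (k + N + 1) ≠ ε (k + N)}

/-!
Write `P(z) = z² - lam`, let `β` be its positive fixed point and `U = ℂ ∖ [-β, β]`. The bound
`lam > 2 + √2` amounts to `lam - β > 1`, that is, to `|P'| > 2` on the Julia set `E₀`. It makes
bounded orbits real (`im_eq_zero_of_bounded`), so that `conv E₀ = [-β, β]`.

*Existence.* Since `P` maps `U` into itself, the Böttcher function
`φ(z) = z ∏ (1 - lam / (P^k z)²)^{1/2^{k+1}}` is given on all of `U` by principal branches. It is
odd, satisfies `φ ∘ P = φ²`, and differs from the identity by `O(1/|z|)` at infinity. Hence it is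
injective (`injOn_bottcher`): injectivity near infinity is pulled back along `P`, whose two inverse
branches differ by a sign. The Green's function is `2^{-n} log |φ(P^n z)|`, and `w ↦ φ⁻¹(1 / w)` is a
Green's mapping (`exists_isGreenMapping`).

*Uniqueness.* By the maximum principle the Green's function is unique (`IsGreenFunction.le`). So for
any Green's mapping `T` the function `w φ(T w)` is unimodular, hence constant, and its value is `1`
(`IsGreenMapping.bottcher_eq`). In particular `T(w²) = P(T w)`.

*The integral.* The set of angles `±e^{-iπF_N}` is compact, invariant under squaring, and does not
contain `-1`; so its radii can be pulled back from a neighbourhood of `0` into the domain `H`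
(`IsGreenMapping.radius_mem`). Differentiating `T(w²) = P(T w)` gives `T'(w) = w T'(w²) / T(w)`. As
`|T| ≥ ρ > 1` near the unit circle, passing from `w²` to `w` multiplies the bound for `T'` by `1 / ρ`
and the bound for `T''` by `2 / ρ`, up to summable errors. The moduli between `r₁^{2^{-n}}` and
`r₁^{2^{-n-1}}` form an interval of length `O(2^{-n})`, so the integral of `|T''|` is dominated by the
convergent series `∑ ρ^{-n}` (`IsGreenMapping.exists_integral_bound`).

*Dimension.* `F_N` contains the numbers whose binary digits form blocks `0 1 x … x` of length `N + 2`
with `N` free digits. Reading off the free digits maps this set onto `[0, 1]` and is Hölder continuous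
with exponent `N / (N + 2) > 1 - 2 / N`, which is therefore a lower bound for the dimension
(`le_dimH_boundedRunSet`).
-/

/-! ### Dynamics of `z² - lam` -/

/-- The quadratic polynomial `P(z) = z² - lam`. -/
def quad (lam : ℝ) (z : ℂ) : ℂ := z ^ 2 - (lam : ℂ)

/-- The repelling fixed point `β = (1 + √(1 + 4 lam)) / 2` of `P`, the right end of the Julia
set. -/
noncomputable def betaPt (lam : ℝ) : ℝ := (1 + Real.sqrt (1 + 4 * lam)) / 2

/-- The complement in `ℂ` of the segment `[-β, β]`, which is the convex hull of the Julia set. -/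
def outer (lam : ℝ) : Set ℂ := {z : ℂ | z.im ≠ 0 ∨ betaPt lam < |z.re|}

section Dynamics

variable {lam : ℝ}

lemma betaPt_sq (hl : 2 + Real.sqrt 2 < lam) : betaPt lam ^ 2 = betaPt lam + lam := by
  have := Real.sqrt_nonneg 2
  have h := Real.sq_sqrt (show 0 ≤ 1 + 4 * lam by linarith)
  unfold betaPt
  nlinarith

lemma two_lt_betaPt (hl : 2 + Real.sqrt 2 < lam) : 2 < betaPt lam := by
  have h2 := Real.sqrt_nonneg 2
  have h22 : (1.4 : ℝ) < Real.sqrt 2 := Real.lt_sqrt_of_sq_lt (by norm_num)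
  have : 3 < Real.sqrt (1 + 4 * lam) := Real.lt_sqrt_of_sq_lt (by linarith)
  unfold betaPt
  linarith

/-- This is where the bound on `lam` enters: it says that `|P'| > 2` on the Julia set. -/
lemma one_lt_lam_sub_betaPt (hl : 2 + Real.sqrt 2 < lam) : 1 < lam - betaPt lam := by
  have h2 := Real.sq_sqrt (show (0 : ℝ) ≤ 2 by norm_num)
  have h0 := Real.sqrt_nonneg 2
  have : Real.sqrt (1 + 4 * lam) < 2 * lam - 3 := by
    rw [Real.sqrt_lt' (by linarith)]
    nlinarith
  unfold betaPt
  linarith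

lemma three_lt_lam (hl : 2 + Real.sqrt 2 < lam) : 3 < lam := by
  have := one_lt_lam_sub_betaPt hl
  have := two_lt_betaPt hl
  linarith

@[simp] lemma quad_neg (z : ℂ) : quad lam (-z) = quad lam z := by simp [quad]

lemma continuous_quad : Continuous (quad lam) := by unfold quad; fun_prop

lemma differentiable_quad_iterate (n : ℕ) : Differentiable ℂ (quad lam)^[n] := by
  apply Differentiable.iterate
  unfold quad
  fun_prop

lemma isOpen_outer : IsOpen (outer lam) := by
  apply IsOpen.union
  · exact isOpen_ne_fun Complex.continuous_im continuous_const
  · exact isOpen_lt continuous_const (Complex.continuous_re.abs)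

lemma ne_zero_of_mem_outer (hl : 2 + Real.sqrt 2 < lam) {z : ℂ} (hz : z ∈ outer lam) : z ≠ 0 := by
  rintro rfl
  have := two_lt_betaPt hl
  rcases hz with h | h
  · simp at h
  · simp at h; linarith

lemma neg_mem_outer {z : ℂ} (hz : z ∈ outer lam) : -z ∈ outer lam := by
  simpa [outer] using hz

lemma mem_outer_of_lt_norm {z : ℂ} (hz : betaPt lam < ‖z‖) : z ∈ outer lam := by
  by_cases h : z.im = 0
  · right
    have : ‖z‖ = |z.re| := by
      conv_lhs => rw [show z = ((z.re : ℝ) : ℂ) from Complex.ext rfl (by simp [h])]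
      simp
    rwa [← this]
  · exact Or.inl h

lemma quad_re (z : ℂ) : (quad lam z).re = z.re ^ 2 - z.im ^ 2 - lam := by
  simp [quad, pow_two]

lemma quad_im (z : ℂ) : (quad lam z).im = 2 * z.re * z.im := by
  simp [quad, pow_two]; ring

/-- If `P z` lies off `[-β, β]` and is not a negative real number, then `z` lies off `[-β, β]`. -/
lemma mem_outer_of_quad_mem_outer (hl : 2 + Real.sqrt 2 < lam) {z : ℂ}
    (hz : quad lam z ∈ outer lam) (h : (quad lam z).im = 0 → 0 < (quad lam z).re) :
    z ∈ outer lam := by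
  by_contra hc
  simp only [outer, Set.mem_ofPred_eq, not_or, not_not, not_lt] at hc
  have hb := betaPt_sq hl
  have h2 := two_lt_betaPt hl
  have him : (quad lam z).im = 0 := by rw [quad_im, hc.1]; ring
  have hpos := h him
  rcases hz with hz | hz
  · exact hz him
  · rw [abs_of_pos hpos, quad_re, hc.1] at hz
    have := sq_le_sq' (abs_le.1 hc.2).1 (abs_le.1 hc.2).2
    nlinarith

lemma quad_mem_outer (hl : 2 + Real.sqrt 2 < lam) {z : ℂ} (hz : z ∈ outer lam) :
    quad lam z ∈ outer lam := by
  by_contra hc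
  simp only [outer, Set.mem_ofPred_eq, not_or, not_not, not_lt, quad_re, quad_im] at hc
  have hb := betaPt_sq hl
  have h2 := two_lt_betaPt hl
  have h3 := one_lt_lam_sub_betaPt hl
  obtain ⟨h4, h5⟩ := hc
  rw [abs_le] at h5
  have him : z.im = 0 := by
    by_contra him
    have : z.re = 0 := by
      rcases mul_eq_zero.1 h4 with h | h
      · linarith
      · exact absurd h him
    rw [this] at h5
    nlinarith [sq_nonneg z.im]
  rcases hz with hz | hz
  · exact hz him
  · rw [him] at h5
    have : betaPt lam ^ 2 < |z.re| ^ 2 := by gcongr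
    rw [sq_abs] at this
    nlinarith

lemma iterate_mem_outer (hl : 2 + Real.sqrt 2 < lam) {z : ℂ} (hz : z ∈ outer lam) (n : ℕ) :
    (quad lam)^[n] z ∈ outer lam := by
  induction n with
  | zero => exact hz
  | succ n ih => rw [Function.iterate_succ_apply']; exact quad_mem_outer hl ih

lemma le_norm_quad_sub (hl : 2 + Real.sqrt 2 < lam) {z : ℂ} (hz : betaPt lam ≤ ‖z‖) :
    4 * (‖z‖ - betaPt lam) ≤ ‖quad lam z‖ - betaPt lam := by
  have hb := betaPt_sq hl
  have h2 := two_lt_betaPt hl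
  have h3 := three_lt_lam hl
  have : ‖z‖ ^ 2 - lam ≤ ‖quad lam z‖ := by
    have := norm_sub_norm_le (z ^ 2) (lam : ℂ)
    rwa [norm_pow, Complex.norm_real, Real.norm_of_nonneg (by linarith)] at this
  nlinarith

lemma le_norm_iterate_sub (hl : 2 + Real.sqrt 2 < lam) {z : ℂ} (hz : betaPt lam ≤ ‖z‖) (n : ℕ) :
    4 ^ n * (‖z‖ - betaPt lam) ≤ ‖(quad lam)^[n] z‖ - betaPt lam := by
  induction n with
  | zero => simp
  | succ n ih =>
    rw [Function.iterate_succ_apply']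
    have h4 : (1 : ℝ) ≤ 4 ^ n := one_le_pow₀ (by norm_num)
    have : betaPt lam ≤ ‖(quad lam)^[n] z‖ := by nlinarith
    have := le_norm_quad_sub hl this
    rw [pow_succ]
    nlinarith

lemma tendsto_norm_iterate (hl : 2 + Real.sqrt 2 < lam) {z : ℂ} (hz : betaPt lam < ‖z‖) :
    Tendsto (fun n => ‖(quad lam)^[n] z‖) atTop atTop := by
  refine tendsto_atTop_mono (f := fun n : ℕ => (4 : ℝ) ^ n * (‖z‖ - betaPt lam)) (fun n => ?_) ?_
  · have := le_norm_iterate_sub hl hz.le n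
    have := two_lt_betaPt hl
    linarith
  · exact (tendsto_pow_atTop_atTop_of_one_lt (by norm_num)).atTop_mul_const (by linarith)

lemma one_lt_sq_re (hl : 2 + Real.sqrt 2 < lam) {z : ℂ} (h : ‖quad lam z‖ ≤ betaPt lam) :
    1 < z.re ^ 2 := by
  have h1 := (abs_le.1 ((Complex.abs_re_le_norm _).trans h)).1
  rw [quad_re] at h1
  have := one_lt_lam_sub_betaPt hl
  nlinarith [sq_nonneg z.im]

/-- A bounded orbit is real: along it `P` expands imaginary parts at least by a factor `2`. -/
lemma im_eq_zero_of_bounded (hl : 2 + Real.sqrt 2 < lam) {z : ℂ}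
    (h : ∀ n, ‖(quad lam)^[n] z‖ ≤ betaPt lam) : z.im = 0 := by
  by_contra hz
  have key : ∀ n : ℕ, 2 ^ n * |z.im| ≤ |((quad lam)^[n] z).im| := by
    intro n
    induction n with
    | zero => simp
    | succ n ih =>
      have h1 := h (n + 1)
      rw [Function.iterate_succ_apply'] at h1 ⊢
      have h2 := one_lt_sq_re hl h1
      have h3 : 1 ≤ |((quad lam)^[n] z).re| := by
        exact ((one_lt_sq_iff_one_lt_abs _).1 h2).le
      rw [quad_im, abs_mul, abs_mul, abs_two, pow_succ]
      nlinarith [abs_nonneg ((quad lam)^[n] z).im]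
  have hz' : 0 < |z.im| := abs_pos.2 hz
  obtain ⟨n, hn⟩ := pow_unbounded_of_one_lt (betaPt lam / |z.im|) (show (1 : ℝ) < 2 by norm_num)
  rw [div_lt_iff₀ hz'] at hn
  have := (Complex.abs_im_le_norm _).trans (h n)
  linarith [key n]

lemma exists_lt_norm_iterate (hl : 2 + Real.sqrt 2 < lam) {z : ℂ} (hz : z ∈ outer lam) :
    ∃ n, betaPt lam < ‖(quad lam)^[n] z‖ := by
  by_contra! hc
  have h0 := im_eq_zero_of_bounded hl hc
  rcases hz with h | h
  · exact h h0
  · exact absurd ((Complex.abs_re_le_norm _).trans (hc 0)) (not_le.2 h)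

lemma tendsto_norm_iterate_of_mem_outer (hl : 2 + Real.sqrt 2 < lam) {z : ℂ}
    (hz : z ∈ outer lam) : Tendsto (fun n => ‖(quad lam)^[n] z‖) atTop atTop := by
  obtain ⟨m, hm⟩ := exists_lt_norm_iterate hl hz
  have := tendsto_norm_iterate hl hm
  simp_rw [← Function.iterate_add_apply] at this
  exact (tendsto_add_atTop_iff_nat (f := fun n => ‖(quad lam)^[n] z‖) m).1 this

lemma mem_juliaSet_compl_iff {z : ℂ} : z ∈ (juliaSet lam)ᶜ ↔
    Tendsto (fun n => ‖(quad lam)^[n] z‖) atTop atTop := by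
  rw [tendsto_norm_atTop_iff_cobounded]
  simp only [juliaSet, Set.mem_compl_iff, Set.mem_ofPred_eq, not_not]
  rfl

lemma outer_subset_compl (hl : 2 + Real.sqrt 2 < lam) : outer lam ⊆ (juliaSet lam)ᶜ :=
  fun _ hz => mem_juliaSet_compl_iff.2 (tendsto_norm_iterate_of_mem_outer hl hz)

lemma mem_compl_iff_exists (hl : 2 + Real.sqrt 2 < lam) {z : ℂ} :
    z ∈ (juliaSet lam)ᶜ ↔ ∃ n, (quad lam)^[n] z ∈ outer lam := by
  rw [mem_juliaSet_compl_iff]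
  constructor
  · intro h
    obtain ⟨n, hn⟩ := (h.eventually_gt_atTop (betaPt lam)).exists
    exact ⟨n, mem_outer_of_lt_norm hn⟩
  · rintro ⟨m, hm⟩
    have := tendsto_norm_iterate_of_mem_outer hl hm
    simp_rw [← Function.iterate_add_apply] at this
    exact (tendsto_add_atTop_iff_nat (f := fun n => ‖(quad lam)^[n] z‖) m).1 this

lemma isOpen_compl_juliaSet (hl : 2 + Real.sqrt 2 < lam) : IsOpen (juliaSet lam)ᶜ := by
  have : (juliaSet lam)ᶜ = ⋃ n, (quad lam)^[n] ⁻¹' outer lam := by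
    ext z; rw [mem_compl_iff_exists hl]; simp
  rw [this]
  exact isOpen_iUnion fun n => isOpen_outer.preimage (continuous_quad.iterate n)

lemma isClosed_juliaSet (hl : 2 + Real.sqrt 2 < lam) : IsClosed (juliaSet lam) :=
  isOpen_compl_iff.1 (isOpen_compl_juliaSet hl)

lemma norm_iterate_le_of_mem_juliaSet (hl : 2 + Real.sqrt 2 < lam) {z : ℂ}
    (hz : z ∈ juliaSet lam) (n : ℕ) : ‖(quad lam)^[n] z‖ ≤ betaPt lam := by
  by_contra! hc
  exact (mem_compl_iff_exists hl).2 ⟨n, mem_outer_of_lt_norm hc⟩ hz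

lemma juliaSet_im (hl : 2 + Real.sqrt 2 < lam) {z : ℂ} (hz : z ∈ juliaSet lam) : z.im = 0 :=
  im_eq_zero_of_bounded hl (norm_iterate_le_of_mem_juliaSet hl hz)

lemma compl_outer_eq_segment (hl : 2 + Real.sqrt 2 < lam) :
    (outer lam)ᶜ = segment ℝ (-(betaPt lam : ℂ)) (betaPt lam : ℂ) := by
  have h2 := two_lt_betaPt hl
  have : segment ℝ (-(betaPt lam : ℂ)) (betaPt lam : ℂ)
      = Complex.ofRealCLM '' Set.Icc (-betaPt lam) (betaPt lam) := by
    rw [← segment_eq_Icc (by linarith)]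
    have := image_segment ℝ (Complex.ofRealCLM.toLinearMap.toAffineMap) (-betaPt lam) (betaPt lam)
    simpa [Complex.ofRealCLM_apply, Function.comp_def] using! this.symm
  rw [this]
  ext z
  simp only [outer, Set.mem_compl_iff, Set.mem_ofPred_eq, not_or, not_not, not_lt, Set.mem_image,
    Set.mem_Icc, Complex.ofRealCLM_apply]
  constructor
  · rintro ⟨h, h'⟩
    exact ⟨z.re, abs_le.1 h', Complex.ext rfl (by simp [h])⟩
  · rintro ⟨x, hx, rfl⟩
    exact ⟨by simp, by simpa [abs_le] using hx⟩

lemma compl_convexHull_juliaSet (hl : 2 + Real.sqrt 2 < lam) :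
    (convexHull ℝ (juliaSet lam))ᶜ = outer lam := by
  rw [compl_eq_comm, compl_outer_eq_segment hl]
  have hfix : quad lam (betaPt lam : ℂ) = betaPt lam := by
    have := betaPt_sq hl
    unfold quad
    rw [← Complex.ofReal_pow, ← Complex.ofReal_sub, this]
    congr 1; ring
  have hb := two_lt_betaPt hl
  have hmem : (betaPt lam : ℂ) ∈ juliaSet lam := by
    by_contra hc
    obtain ⟨n, hn⟩ := (mem_compl_iff_exists hl).1 hc
    rw [Function.iterate_fixed hfix] at hn
    simp [outer, abs_of_pos (show 0 < betaPt lam by linarith)] at hn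
  have hmem' : -(betaPt lam : ℂ) ∈ juliaSet lam := by
    by_contra hc
    obtain ⟨n, hn⟩ := (mem_compl_iff_exists hl).1 hc
    cases n with
    | zero => simp [outer, abs_of_pos (show 0 < betaPt lam by linarith)] at hn
    | succ n =>
      rw [Function.iterate_succ_apply, quad_neg, ← Function.iterate_succ_apply] at hn
      exact (mem_compl_iff_exists hl).2 ⟨_, hn⟩ hmem
  apply subset_antisymm
  · rw [← convexHull_pair]
    exact convexHull_mono (by rintro x (rfl | rfl) <;> assumption)
  · apply convexHull_min _ (convex_segment _ _)
    rw [← compl_outer_eq_segment hl]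
    exact fun z hz hz' => outer_subset_compl hl hz' hz

/-- `ℂ ∖ [-β, β]` is connected: it is the union of two star-shaped slit planes. -/
lemma isPreconnected_outer (hl : 2 + Real.sqrt 2 < lam) : IsPreconnected (outer lam) := by
  have hb := two_lt_betaPt hl
  have key : IsPreconnected {z : ℂ | z.im ≠ 0 ∨ betaPt lam < z.re} := by
    have : {z : ℂ | z.im ≠ 0 ∨ betaPt lam < z.re}
        = (fun z : ℂ => z + betaPt lam) '' Complex.slitPlane := by
      ext z
      simp only [Set.mem_ofPred_eq, Set.mem_image, Complex.mem_slitPlane_iff]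
      constructor
      · intro h
        exact ⟨z - betaPt lam, by simpa [or_comm] using h, by simp⟩
      · rintro ⟨w, hw, rfl⟩
        simpa [or_comm] using hw
    rw [this]
    exact (Complex.starConvex_one_slitPlane.isPathConnected
      Complex.one_mem_slitPlane).isConnected.isPreconnected.image _ (by fun_prop)
  have key' : IsPreconnected {z : ℂ | z.im ≠ 0 ∨ betaPt lam < -z.re} := by
    have : {z : ℂ | z.im ≠ 0 ∨ betaPt lam < -z.re}
        = (fun z : ℂ => -z) '' {z : ℂ | z.im ≠ 0 ∨ betaPt lam < z.re} := by
      ext z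
      simp
    rw [this]
    exact key.image _ (by fun_prop)
  have : outer lam = {z : ℂ | z.im ≠ 0 ∨ betaPt lam < z.re} ∪
      {z : ℂ | z.im ≠ 0 ∨ betaPt lam < -z.re} := by
    ext z
    simp only [outer, Set.mem_ofPred_eq, Set.mem_union, lt_abs]
    tauto
  rw [this]
  exact key.union Complex.I (by simp) (by simp) key'

end Dynamics

/-! ### The Böttcher function -/

/-- The `k`-th summand `2^{-(k+1)} Log (1 - lam / (P^k z)²)` of the logarithm of `φ(z) / z`, where
`φ` is the Böttcher function. Off `[-β, β]` the argument of the principal branch `Log` stays in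
the slit plane. -/
noncomputable def bottcherTerm (lam : ℝ) (k : ℕ) (z : ℂ) : ℂ :=
  (1 / 2) ^ (k + 1) * Complex.log (1 - lam / (quad lam)^[k] z ^ 2)

/-- A logarithm of `φ(z) / z`, where `φ` is the Böttcher function. -/
noncomputable def bottcherSum (lam : ℝ) (z : ℂ) : ℂ := ∑' k, bottcherTerm lam k z

/-- The Böttcher function `φ` of `P`, a branch of `lim (P^n z)^{1/2^n}` that is meaningful on
`ℂ ∖ [-β, β]`; there `1 / φ` is the complex Green's function. -/
noncomputable def bottcher (lam : ℝ) (z : ℂ) : ℂ := z * Complex.exp (bottcherSum lam z)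

section Bottcher

variable {lam : ℝ}

lemma one_sub_mem_slitPlane (hl : 2 + Real.sqrt 2 < lam) {w : ℂ} (hw : w ∈ outer lam) :
    1 - lam / w ^ 2 ∈ Complex.slitPlane := by
  have hw0 := ne_zero_of_mem_outer hl hw
  have hb := betaPt_sq hl
  have h2 := two_lt_betaPt hl
  have h3 := three_lt_lam hl
  by_contra hc
  rw [Complex.mem_slitPlane_iff, not_or, not_lt, not_not] at hc
  obtain ⟨s, hs1, hs⟩ : ∃ s : ℝ, 1 ≤ s ∧ (lam : ℂ) / w ^ 2 = s := by
    refine ⟨((lam : ℂ) / w ^ 2).re, ?_, Complex.ext rfl ?_⟩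
    · have := hc.1
      rw [Complex.sub_re, Complex.one_re] at this
      linarith
    · have := hc.2
      rw [Complex.sub_im, Complex.one_im] at this
      rw [Complex.ofReal_im]
      linarith
  have hsq : w ^ 2 = ((lam / s : ℝ) : ℂ) := by
    rw [div_eq_iff (pow_ne_zero 2 hw0)] at hs
    rw [Complex.ofReal_div, hs, mul_div_cancel_left₀]
    exact_mod_cast (by linarith : s ≠ 0)
  have hre := congrArg Complex.re hsq
  have him := congrArg Complex.im hsq
  simp only [pow_two, Complex.mul_re, Complex.mul_im, Complex.ofReal_re, Complex.ofReal_im]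
    at hre him
  have hle : lam / s ≤ lam := div_le_self (by linarith) hs1
  have hpos : 0 < lam / s := by positivity
  have : w.im = 0 := by
    by_contra h
    have : w.re = 0 := by
      have : w.re * w.im = 0 := by linarith
      exact (mul_eq_zero.1 this).resolve_right h
    rw [this] at hre
    nlinarith [sq_nonneg w.im]
  rcases hw with h | h
  · exact h this
  · rw [this] at hre
    have : betaPt lam ^ 2 < |w.re| ^ 2 := by gcongr
    rw [sq_abs] at this
    nlinarith

/-- The radius `6 lam + 6` serves as the threshold for a neighbourhood of infinity in the estimates
for the Böttcher function: beyond it moduli do not decrease along orbits, the bound `|Log (1 + u)|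
≤ 3 |u| / 2` applies to `u = -lam / z²`, and `|φ(z) - z| ≤ 3 lam / |z| ≤ 1 / 2`. -/
lemma norm_le_norm_iterate (hl : 2 + Real.sqrt 2 < lam) {z : ℂ} (hz : 6 * lam + 6 ≤ ‖z‖) (n : ℕ) :
    ‖z‖ ≤ ‖(quad lam)^[n] z‖ := by
  have h3 := one_lt_lam_sub_betaPt hl
  have h2 := two_lt_betaPt hl
  have := le_norm_iterate_sub hl (show betaPt lam ≤ ‖z‖ by linarith) n
  have h4 : (1 : ℝ) ≤ 4 ^ n := one_le_pow₀ (by norm_num)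
  nlinarith

lemma mem_outer_of_large (hl : 2 + Real.sqrt 2 < lam) {z : ℂ} (hz : 6 * lam + 6 ≤ ‖z‖) :
    z ∈ outer lam := by
  have h3 := one_lt_lam_sub_betaPt hl
  have h2 := two_lt_betaPt hl
  exact mem_outer_of_lt_norm (by linarith)

lemma norm_log_le (hl : 2 + Real.sqrt 2 < lam) {w : ℂ} (hw : 6 * lam + 6 ≤ ‖w‖) :
    ‖Complex.log (1 - lam / w ^ 2)‖ ≤ 3 / 2 * (lam / ‖w‖ ^ 2) := by
  have h3 := three_lt_lam hl
  have hn : ‖-((lam : ℂ) / w ^ 2)‖ = lam / ‖w‖ ^ 2 := by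
    rw [norm_neg, norm_div, norm_pow, Complex.norm_real, Real.norm_of_nonneg (by linarith)]
  have hw0 : 0 < ‖w‖ := by linarith
  have := Complex.norm_log_one_add_half_le_self (z := -((lam : ℂ) / w ^ 2)) (by
    rw [hn, div_le_iff₀ (by positivity)]
    nlinarith)
  rwa [hn, ← sub_eq_add_neg] at this

lemma norm_bottcherTerm_le (hl : 2 + Real.sqrt 2 < lam) {z : ℂ} (hz : 6 * lam + 6 ≤ ‖z‖) (k : ℕ) :
    ‖bottcherTerm lam k z‖ ≤ 3 / 2 * (lam / ‖z‖ ^ 2) * (1 / 2) ^ (k + 1) := by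
  have h3 := three_lt_lam hl
  have h := norm_le_norm_iterate hl hz k
  have h1 := norm_log_le hl (hz.trans h)
  have h2 : lam / ‖(quad lam)^[k] z‖ ^ 2 ≤ lam / ‖z‖ ^ 2 := by
    have : 0 < ‖z‖ := by linarith
    gcongr
  have hp : ‖((1 : ℂ) / 2) ^ (k + 1)‖ = (1 / 2) ^ (k + 1) := by simp
  rw [bottcherTerm, norm_mul, hp, mul_comm]
  gcongr
  linarith

lemma hasSum_half_pow_succ : HasSum (fun k : ℕ => ((1 : ℝ) / 2) ^ (k + 1)) 1 := by
  simpa [pow_succ] using hasSum_geometric_two.mul_right (1 / 2 : ℝ)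

lemma bottcherTerm_succ (k : ℕ) (z : ℂ) :
    bottcherTerm lam (k + 1) z = 1 / 2 * bottcherTerm lam k (quad lam z) := by
  simp only [bottcherTerm, Function.iterate_succ_apply]
  ring

lemma summable_bottcherTerm (hl : 2 + Real.sqrt 2 < lam) {z : ℂ} (hz : z ∈ outer lam) :
    Summable (fun k => bottcherTerm lam k z) := by
  obtain ⟨n, hn⟩ := ((tendsto_norm_iterate_of_mem_outer hl hz).eventually_ge_atTop
    (6 * lam + 6)).exists
  clear hz
  induction n generalizing z with
  | zero =>
    exact .of_norm_bounded (hasSum_half_pow_succ.summable.mul_left _)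
      (fun k => norm_bottcherTerm_le hl hn k)
  | succ n ih =>
    rw [Function.iterate_succ_apply] at hn
    rw [← summable_nat_add_iff 1]
    simp_rw [bottcherTerm_succ]
    exact (ih hn).mul_left _

lemma bottcherSum_eq (hl : 2 + Real.sqrt 2 < lam) {z : ℂ} (hz : z ∈ outer lam) :
    bottcherSum lam z = 1 / 2 * Complex.log (1 - lam / z ^ 2)
      + 1 / 2 * bottcherSum lam (quad lam z) := by
  rw [bottcherSum, (summable_bottcherTerm hl hz).tsum_eq_zero_add]
  simp_rw [bottcherTerm_succ]
  rw [tsum_mul_left]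
  simp [bottcherTerm, bottcherSum]

/-- The Böttcher function conjugates `P` to `w ↦ w²`. -/
lemma bottcher_quad (hl : 2 + Real.sqrt 2 < lam) {z : ℂ} (hz : z ∈ outer lam) :
    bottcher lam (quad lam z) = bottcher lam z ^ 2 := by
  have h0 := ne_zero_of_mem_outer hl hz
  have h1 := Complex.slitPlane_ne_zero (one_sub_mem_slitPlane hl hz)
  have : Complex.exp (bottcherSum lam z) ^ 2
      = (1 - lam / z ^ 2) * Complex.exp (bottcherSum lam (quad lam z)) := by
    rw [← Complex.exp_nat_mul, bottcherSum_eq hl hz, Nat.cast_ofNat, mul_add, ← mul_assoc,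
      ← mul_assoc]
    norm_num
    rw [Complex.exp_add, Complex.exp_log h1]
  rw [bottcher, bottcher, mul_pow, this, ← mul_assoc, mul_sub, mul_one,
    mul_div_cancel₀ _ (pow_ne_zero 2 h0), quad]

lemma bottcher_iterate (hl : 2 + Real.sqrt 2 < lam) {z : ℂ} (hz : z ∈ outer lam) (n : ℕ) :
    bottcher lam ((quad lam)^[n] z) = bottcher lam z ^ 2 ^ n := by
  induction n with
  | zero => simp
  | succ n ih =>
    rw [Function.iterate_succ_apply', bottcher_quad hl (iterate_mem_outer hl hz n), ih, ← pow_mul,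
      pow_succ]

lemma bottcher_ne_zero (hl : 2 + Real.sqrt 2 < lam) {z : ℂ} (hz : z ∈ outer lam) :
    bottcher lam z ≠ 0 :=
  mul_ne_zero (ne_zero_of_mem_outer hl hz) (Complex.exp_ne_zero _)

lemma bottcher_neg (z : ℂ) : bottcher lam (-z) = -bottcher lam z := by
  have : bottcherSum lam (-z) = bottcherSum lam z := by
    unfold bottcherSum
    congr 1
    ext k
    cases k with
    | zero => simp [bottcherTerm]
    | succ k => rw [bottcherTerm_succ, bottcherTerm_succ, quad_neg]
  rw [bottcher, this, bottcher, neg_mul]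

lemma differentiableAt_bottcherSum (hl : 2 + Real.sqrt 2 < lam) {z : ℂ} (hz : z ∈ outer lam) :
    DifferentiableAt ℂ (bottcherSum lam) z := by
  have h3 := three_lt_lam hl
  obtain ⟨n, hn⟩ := ((tendsto_norm_iterate_of_mem_outer hl hz).eventually_gt_atTop
    (6 * lam + 6)).exists
  have hlog : ∀ w ∈ outer lam, DifferentiableAt ℂ (fun z => Complex.log (1 - lam / z ^ 2)) w := by
    intro w hw
    have h0 := ne_zero_of_mem_outer hl hw
    have hd : DifferentiableAt ℂ (fun z : ℂ => 1 - lam / z ^ 2) w := by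
      fun_prop (disch := exact pow_ne_zero 2 h0)
    exact hd.clog (one_sub_mem_slitPlane hl hw)
  induction n generalizing z with
  | zero =>
    have hV : IsOpen {z : ℂ | 6 * lam + 6 < ‖z‖} := isOpen_lt continuous_const continuous_norm
    refine (DifferentiableOn.differentiableAt (s := {z : ℂ | 6 * lam + 6 < ‖z‖}) ?_
      (hV.mem_nhds hn))
    refine Complex.differentiableOn_tsum_of_summable_norm
      (hasSum_half_pow_succ.summable.mul_left 1) (fun k w hw => ?_) hV (fun k w hw => ?_)
    · have := hlog _ (iterate_mem_outer hl (mem_outer_of_large hl (le_of_lt hw)) k)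
      exact ((this.comp w (differentiable_quad_iterate k w)).const_mul _).differentiableWithinAt
    · refine (norm_bottcherTerm_le hl (le_of_lt hw) k).trans ?_
      gcongr
      have hw' : 6 * lam + 6 < ‖w‖ := hw
      have hw0 : 0 < ‖w‖ := by linarith
      rw [← mul_div_assoc, div_le_one (by positivity)]
      nlinarith
  | succ n ih =>
    rw [Function.iterate_succ_apply] at hn
    have h1 := ih (quad_mem_outer hl hz) hn
    have h2 : DifferentiableAt ℂ (quad lam) z := differentiable_quad_iterate 1 z
    have : bottcherSum lam =ᶠ[𝓝 z] fun z => 1 / 2 * Complex.log (1 - lam / z ^ 2)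
      + 1 / 2 * bottcherSum lam (quad lam z) := by
      filter_upwards [isOpen_outer.mem_nhds hz] with w hw using bottcherSum_eq hl hw
    refine DifferentiableAt.congr_of_eventuallyEq ?_ this
    exact ((hlog z hz).const_mul _).add ((h1.comp z h2).const_mul _)

lemma differentiableAt_bottcher (hl : 2 + Real.sqrt 2 < lam) {z : ℂ} (hz : z ∈ outer lam) :
    DifferentiableAt ℂ (bottcher lam) z :=
  differentiableAt_id.mul (differentiableAt_bottcherSum hl hz).cexp

lemma analyticAt_bottcher (hl : 2 + Real.sqrt 2 < lam) {z : ℂ} (hz : z ∈ outer lam) :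
    AnalyticAt ℂ (bottcher lam) z :=
  DifferentiableOn.analyticAt
    (fun _ hw => (differentiableAt_bottcher hl hw).differentiableWithinAt)
    (isOpen_outer.mem_nhds hz)

lemma norm_bottcherSum_le (hl : 2 + Real.sqrt 2 < lam) {z : ℂ} (hz : 6 * lam + 6 ≤ ‖z‖) :
    ‖bottcherSum lam z‖ ≤ 3 / 2 * (lam / ‖z‖ ^ 2) := by
  have := hasSum_half_pow_succ.mul_left (3 / 2 * (lam / ‖z‖ ^ 2))
  rw [mul_one] at this
  exact tsum_of_norm_bounded this (norm_bottcherTerm_le hl hz)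

lemma norm_bottcher_sub_le (hl : 2 + Real.sqrt 2 < lam) {z : ℂ} (hz : 6 * lam + 6 ≤ ‖z‖) :
    ‖bottcher lam z - z‖ ≤ 3 * lam / ‖z‖ := by
  have h3 := three_lt_lam hl
  have hz0 : 0 < ‖z‖ := by linarith
  have h := norm_bottcherSum_le hl hz
  have h1 : 3 / 2 * (lam / ‖z‖ ^ 2) ≤ 1 := by
    rw [← mul_div_assoc, div_le_one (by positivity)]
    nlinarith
  have h2 := Complex.norm_exp_sub_one_le (h.trans h1)
  rw [bottcher, show z * Complex.exp (bottcherSum lam z) - z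
    = z * (Complex.exp (bottcherSum lam z) - 1) by ring, norm_mul]
  calc ‖z‖ * ‖Complex.exp (bottcherSum lam z) - 1‖
      ≤ ‖z‖ * (2 * (3 / 2 * (lam / ‖z‖ ^ 2))) := by gcongr; linarith
    _ = 3 * lam / ‖z‖ := by field_simp

lemma norm_bottcher_sub_le_half (hl : 2 + Real.sqrt 2 < lam) {z : ℂ} (hz : 6 * lam + 6 ≤ ‖z‖) :
    ‖bottcher lam z - z‖ ≤ 1 / 2 := by
  have h3 := three_lt_lam hl
  refine (norm_bottcher_sub_le hl hz).trans ?_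
  rw [div_le_iff₀ (by linarith)]
  linarith

lemma tendsto_bottcher_div (hl : 2 + Real.sqrt 2 < lam) :
    Tendsto (fun z => bottcher lam z / z) (cobounded ℂ) (𝓝 1) := by
  have h3 := three_lt_lam hl
  have hS : Tendsto (bottcherSum lam) (cobounded ℂ) (𝓝 0) := by
    rw [tendsto_zero_iff_norm_tendsto_zero]
    have hlim : Tendsto (fun z : ℂ => 3 / 2 * (lam / ‖z‖ ^ 2)) (cobounded ℂ) (𝓝 0) := by
      rw [show (0 : ℝ) = 3 / 2 * 0 by ring]
      refine Tendsto.const_mul _ (Tendsto.const_div_atTop ?_ _)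
      exact (tendsto_pow_atTop two_ne_zero).comp tendsto_norm_cobounded_atTop
    refine tendsto_of_tendsto_of_tendsto_of_le_of_le' tendsto_const_nhds hlim
      (Eventually.of_forall fun _ => norm_nonneg _) ?_
    filter_upwards [tendsto_norm_cobounded_atTop.eventually_ge_atTop (6 * lam + 6)] with z hz
      using norm_bottcherSum_le hl hz
  have := (Complex.continuous_exp.tendsto 0).comp hS
  rw [Complex.exp_zero] at this
  refine this.congr' ?_
  filter_upwards [tendsto_norm_cobounded_atTop.eventually_gt_atTop 0] with z hz
  rw [bottcher, mul_div_cancel_left₀ _ (norm_pos_iff.1 hz), Function.comp_apply]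

lemma one_lt_norm_bottcher (hl : 2 + Real.sqrt 2 < lam) {z : ℂ} (hz : z ∈ outer lam) :
    1 < ‖bottcher lam z‖ := by
  have h3 := three_lt_lam hl
  obtain ⟨n, hn⟩ := ((tendsto_norm_iterate_of_mem_outer hl hz).eventually_ge_atTop
    (6 * lam + 6)).exists
  have h1 := norm_bottcher_sub_le_half hl hn
  have h2 := norm_sub_norm_le ((quad lam)^[n] z) (bottcher lam ((quad lam)^[n] z))
  rw [norm_sub_rev, bottcher_iterate hl hz, norm_pow] at h2
  rw [bottcher_iterate hl hz] at h1
  by_contra! hc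
  have := pow_le_one₀ (norm_nonneg (bottcher lam z)) hc (n := 2 ^ n)
  linarith

/-- On `(-∞, -β)` the Böttcher function is real and negative. -/
lemma bottcher_ofReal_neg (hl : 2 + Real.sqrt 2 < lam) {x : ℝ} (hx : x < -betaPt lam) :
    ∃ t : ℝ, t < 0 ∧ bottcher lam x = t := by
  have h2 := two_lt_betaPt hl
  have hx' : (x : ℂ) ∈ outer lam := Or.inr (by simp [lt_abs]; right; linarith)
  have hreal : ∀ k, ∃ y : ℝ, (quad lam)^[k] (x : ℂ) = y := by
    intro k
    induction k with
    | zero => exact ⟨x, rfl⟩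
    | succ k ih =>
      obtain ⟨y, hy⟩ := ih
      exact ⟨y ^ 2 - lam, by rw [Function.iterate_succ_apply', hy, quad]; simp⟩
  have hterm : ∀ k, (bottcherTerm lam k x).im = 0 := by
    intro k
    have hs := one_sub_mem_slitPlane hl (iterate_mem_outer hl hx' k)
    obtain ⟨y, hy⟩ := hreal k
    rw [bottcherTerm]
    rw [hy] at hs ⊢
    have e : (1 : ℂ) - lam / (y : ℂ) ^ 2 = ((1 - lam / y ^ 2 : ℝ) : ℂ) := by simp
    rw [e, Complex.ofReal_mem_slitPlane] at hs
    rw [e, ← Complex.ofReal_log hs.le]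
    have : ((1 : ℂ) / 2) ^ (k + 1) = (((1 : ℝ) / 2) ^ (k + 1) : ℝ) := by simp
    rw [this, ← Complex.ofReal_mul, Complex.ofReal_im]
  have hS : (bottcherSum lam x).im = 0 := by
    rw [bottcherSum, Complex.im_tsum (summable_bottcherTerm hl hx')]
    simp [hterm]
  refine ⟨x * Real.exp (bottcherSum lam x).re,
    mul_neg_of_neg_of_pos (by linarith) (Real.exp_pos _), ?_⟩
  rw [bottcher]
  conv_lhs => rw [show bottcherSum lam x = ((bottcherSum lam x).re : ℂ) from
    Complex.ext rfl (by simp [hS])]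
  simp

/-- The Böttcher function is injective. Along two orbits with the same Böttcher values the
distance contracts by a factor `3` backwards near infinity, so the orbits agree from some time
on; and equality can be pulled back one step at a time because `P z = P w` means `z = ±w`
and the Böttcher function is odd. -/
lemma injOn_bottcher (hl : 2 + Real.sqrt 2 < lam) : Set.InjOn (bottcher lam) (outer lam) := by
  have h3 := three_lt_lam hl
  have hfar : ∀ z w : ℂ, bottcher lam z = bottcher lam w → 6 * lam + 6 ≤ ‖z‖ →
      6 * lam + 6 ≤ ‖w‖ → z = w := by
    have hclose : ∀ z w : ℂ, bottcher lam z = bottcher lam w → 6 * lam + 6 ≤ ‖z‖ →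
        6 * lam + 6 ≤ ‖w‖ → ‖z - w‖ ≤ 1 := by
      intro z w hzw hz hw
      have h1 := norm_bottcher_sub_le_half hl hz
      have h2 := norm_bottcher_sub_le_half hl hw
      rw [norm_sub_rev] at h1
      have := norm_add_le (z - bottcher lam z) (bottcher lam w - w)
      rw [show z - bottcher lam z + (bottcher lam w - w) = z - w by rw [hzw]; ring] at this
      linarith
    -- `P z - P w = (z - w) (z + w)`, where `|z + w| ≥ 3` because `|z| ≥ 2` and `|z - w| ≤ 1`.
    have key : ∀ n (z w : ℂ), bottcher lam z = bottcher lam w → 6 * lam + 6 ≤ ‖z‖ →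
      6 * lam + 6 ≤ ‖w‖ → 3 ^ n * ‖z - w‖ ≤ 1 := by
      intro n
      induction n with
      | zero =>
        intro z w hzw hz hw
        simpa using hclose z w hzw hz hw
      | succ n ih =>
        intro z w hzw hz hw
        have h0 := hclose z w hzw hz hw
        have h1 := ih (quad lam z) (quad lam w)
          (by rw [bottcher_quad hl (mem_outer_of_large hl hz),
            bottcher_quad hl (mem_outer_of_large hl hw), hzw])
          (hz.trans (norm_le_norm_iterate hl hz 1)) (hw.trans (norm_le_norm_iterate hl hw 1))
        rw [show quad lam z - quad lam w = (z - w) * (z + w) by unfold quad; ring, norm_mul] at h1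
        have h2 : 3 ≤ ‖z + w‖ := by
          have := norm_sub_norm_le (2 * z) (z - w)
          rw [show 2 * z - (z - w) = z + w by ring, norm_mul, Complex.norm_ofNat] at this
          linarith
        calc 3 ^ (n + 1) * ‖z - w‖ = 3 ^ n * (‖z - w‖ * 3) := by ring
          _ ≤ 3 ^ n * (‖z - w‖ * ‖z + w‖) := by gcongr
          _ ≤ 1 := h1
    intro z w hzw hz hw
    by_contra hne
    have hpos : 0 < ‖z - w‖ := norm_pos_iff.2 (sub_ne_zero.2 hne)
    obtain ⟨n, hn⟩ := pow_unbounded_of_one_lt (1 / ‖z - w‖) (show (1 : ℝ) < 3 by norm_num)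
    rw [div_lt_iff₀ hpos] at hn
    linarith [key n z w hzw hz hw]
  intro z hz w hw hzw
  obtain ⟨n, hn, hn'⟩ := (((tendsto_norm_iterate_of_mem_outer hl hz).eventually_ge_atTop
    (6 * lam + 6)).and ((tendsto_norm_iterate_of_mem_outer hl hw).eventually_ge_atTop
    (6 * lam + 6))).exists
  have heq : (quad lam)^[n] z = (quad lam)^[n] w :=
    hfar _ _ (by rw [bottcher_iterate hl hz, bottcher_iterate hl hw, hzw]) hn hn'
  clear hn hn'
  induction n generalizing z w with
  | zero => exact heq
  | succ n ih =>
    rw [Function.iterate_succ_apply, Function.iterate_succ_apply] at heq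
    have h1 := ih (quad_mem_outer hl hz) (quad_mem_outer hl hw)
      (by rw [bottcher_quad hl hz, bottcher_quad hl hw, hzw]) heq
    have h2 : z ^ 2 = w ^ 2 := by simpa [quad] using h1
    rcases sq_eq_sq_iff_eq_or_eq_neg.1 h2 with h | h
    · exact h
    · exfalso
      rw [h, bottcher_neg] at hzw
      exact bottcher_ne_zero hl hw (neg_eq_self.1 hzw)

/-- Near infinity this follows from Cauchy's estimate for `φ(z) - z`; elsewhere from the chain rule in
`φ ∘ P = φ²`. -/
lemma deriv_bottcher_ne_zero (hl : 2 + Real.sqrt 2 < lam) {z : ℂ} (hz : z ∈ outer lam) :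
    deriv (bottcher lam) z ≠ 0 := by
  have h3 := three_lt_lam hl
  obtain ⟨n, hn⟩ := ((tendsto_norm_iterate_of_mem_outer hl hz).eventually_ge_atTop
    (6 * lam + 7)).exists
  induction n generalizing z with
  | zero =>
    have hball : ∀ w ∈ Metric.closedBall z 1, 6 * lam + 6 ≤ ‖w‖ := by
      intro w hw
      rw [mem_closedBall_iff_norm, norm_sub_rev] at hw
      have := norm_sub_norm_le z w
      rw [Function.iterate_zero, id_eq] at hn
      linarith
    have hd : ∀ w ∈ Metric.closedBall z 1, DifferentiableAt ℂ (fun w => bottcher lam w - w) w :=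
      fun w hw => (differentiableAt_bottcher hl (mem_outer_of_large hl (hball w hw))).sub
        differentiableAt_id
    have h1 := Complex.norm_deriv_le_of_forall_mem_sphere_norm_le (f := fun w => bottcher lam w - w)
      (c := z) (C := 1 / 2) one_pos
      (DifferentiableOn.diffContOnCl_ball (U := Metric.closedBall z 1)
        (fun w hw => (hd w hw).differentiableWithinAt) subset_rfl)
      (fun w hw => norm_bottcher_sub_le_half hl (hball w (Metric.sphere_subset_closedBall hw)))
    have h2 : deriv (fun w => bottcher lam w - w) z = deriv (bottcher lam) z - 1 := by
      have := deriv_fun_sub (differentiableAt_bottcher hl hz) (differentiableAt_id (𝕜 := ℂ))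
      simpa using this
    intro h0
    rw [h2, h0] at h1
    norm_num at h1
  | succ n ih =>
    rw [Function.iterate_succ_apply] at hn
    have h1 := ih (quad_mem_outer hl hz) hn
    have e : (fun w => bottcher lam (quad lam w)) =ᶠ[𝓝 z] fun w => bottcher lam w ^ 2 := by
      filter_upwards [isOpen_outer.mem_nhds hz] with w hw using bottcher_quad hl hw
    have hq : HasDerivAt (quad lam) (2 * z) z := by
      unfold quad
      simpa using (hasDerivAt_pow 2 z).sub_const (lam : ℂ)
    have d1 := ((differentiableAt_bottcher hl (quad_mem_outer hl hz)).hasDerivAt).comp z hq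
    have d2 := ((differentiableAt_bottcher hl hz).hasDerivAt.pow 2).congr_of_eventuallyEq e
    have := d1.unique d2
    intro h0
    rw [h0, mul_zero] at this
    exact mul_ne_zero h1 (mul_ne_zero two_ne_zero (ne_zero_of_mem_outer hl hz)) this

/-- The Böttcher function is open. -/
lemma map_bottcher_nhds (hl : 2 + Real.sqrt 2 < lam) {z : ℂ} (hz : z ∈ outer lam) :
    map (bottcher lam) (𝓝 z) = 𝓝 (bottcher lam z) :=
  (analyticAt_bottcher hl hz).hasStrictDerivAt.map_nhds_eq (deriv_bottcher_ne_zero hl hz)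

end Bottcher

/-! ### The Green's function and the existence of the Green's mapping -/

/-- The Green's function of the complement of the Julia set: `2^{-n} log |φ (P^n z)|` for any `n`
such that `P^n z` lies off `[-β, β]`, and `0` on the Julia set, where there is no such `n`. -/
noncomputable def greenFun (lam : ℝ) (z : ℂ) : ℝ := by
  classical exact
    if h : ∃ n, (quad lam)^[n] z ∈ outer lam then
      Real.log ‖bottcher lam ((quad lam)^[h.choose] z)‖ / 2 ^ h.choose
    else 0

section Green

variable {lam : ℝ}

lemma greenFun_eq (hl : 2 + Real.sqrt 2 < lam) {z : ℂ} {n : ℕ} (hn : (quad lam)^[n] z ∈ outer lam) :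
    greenFun lam z = Real.log ‖bottcher lam ((quad lam)^[n] z)‖ / 2 ^ n := by
  have key : ∀ m k : ℕ, (quad lam)^[m] z ∈ outer lam →
      Real.log ‖bottcher lam ((quad lam)^[k + m] z)‖ / 2 ^ (k + m)
        = Real.log ‖bottcher lam ((quad lam)^[m] z)‖ / 2 ^ m := by
    intro m k hm
    rw [Function.iterate_add_apply, bottcher_iterate hl hm, norm_pow, Real.log_pow, pow_add]
    push_cast
    rw [mul_div_mul_left _ _ (by positivity)]
  have h : ∃ n, (quad lam)^[n] z ∈ outer lam := ⟨n, hn⟩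
  rw [greenFun, dif_pos h, ← key n h.choose hn, add_comm, key h.choose n h.choose_spec]

lemma greenFun_eq_of_mem_outer (hl : 2 + Real.sqrt 2 < lam) {z : ℂ} (hz : z ∈ outer lam) :
    greenFun lam z = Real.log ‖bottcher lam z‖ := by
  simpa using greenFun_eq hl (n := 0) hz

lemma greenFun_iterate (hl : 2 + Real.sqrt 2 < lam) {z : ℂ} (hz : z ∈ (juliaSet lam)ᶜ) (n : ℕ) :
    greenFun lam z = greenFun lam ((quad lam)^[n] z) / 2 ^ n := by
  obtain ⟨m, hm⟩ := (mem_compl_iff_exists hl).1 hz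
  have h1 := iterate_mem_outer hl hm n
  rw [← Function.iterate_add_apply] at h1
  have h2 := h1
  rw [add_comm, Function.iterate_add_apply] at h2
  rw [greenFun_eq hl h1, greenFun_eq hl h2, ← Function.iterate_add_apply, add_comm m n, pow_add,
    div_div, mul_comm]

lemma iterate_mem_compl (hl : 2 + Real.sqrt 2 < lam) {z : ℂ} (hz : z ∈ (juliaSet lam)ᶜ) (n : ℕ) :
    (quad lam)^[n] z ∈ (juliaSet lam)ᶜ := by
  obtain ⟨m, hm⟩ := (mem_compl_iff_exists hl).1 hz
  refine (mem_compl_iff_exists hl).2 ⟨m, ?_⟩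
  rw [← Function.iterate_add_apply, add_comm, Function.iterate_add_apply]
  exact iterate_mem_outer hl hm n

lemma greenFun_pos (hl : 2 + Real.sqrt 2 < lam) {z : ℂ} (hz : z ∈ (juliaSet lam)ᶜ) :
    0 < greenFun lam z := by
  obtain ⟨n, hn⟩ := (mem_compl_iff_exists hl).1 hz
  rw [greenFun_eq hl hn]
  exact div_pos (Real.log_pos (one_lt_norm_bottcher hl hn)) (by positivity)

/-- The shift by `β` works because `β + lam = β²`. -/
lemma norm_iterate_add_le (hl : 2 + Real.sqrt 2 < lam) (z : ℂ) (n : ℕ) :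
    ‖(quad lam)^[n] z‖ + betaPt lam ≤ (‖z‖ + betaPt lam) ^ 2 ^ n := by
  have h2 := two_lt_betaPt hl
  have hb := betaPt_sq hl
  have h3 := three_lt_lam hl
  induction n with
  | zero => simp
  | succ n ih =>
    rw [Function.iterate_succ_apply', pow_succ, pow_mul]
    have h1 : ‖quad lam ((quad lam)^[n] z)‖ ≤ ‖(quad lam)^[n] z‖ ^ 2 + lam := by
      have := norm_sub_le (((quad lam)^[n] z) ^ 2) (lam : ℂ)
      rwa [norm_pow, Complex.norm_real, Real.norm_of_nonneg (by linarith)] at this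
    have h0 := norm_nonneg ((quad lam)^[n] z)
    calc ‖quad lam ((quad lam)^[n] z)‖ + betaPt lam
        ≤ (‖(quad lam)^[n] z‖ + betaPt lam) ^ 2 := by nlinarith
      _ ≤ _ := by gcongr

lemma greenFun_le (hl : 2 + Real.sqrt 2 < lam) {z : ℂ} (hz : z ∈ (juliaSet lam)ᶜ) :
    greenFun lam z ≤ Real.log (‖z‖ + betaPt lam) := by
  have h2 := two_lt_betaPt hl
  have h3 := three_lt_lam hl
  have hlim : Tendsto (fun n : ℕ => Real.log 2 * (1 / 2) ^ n + Real.log (‖z‖ + betaPt lam)) atTop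
      (𝓝 (Real.log 2 * 0 + Real.log (‖z‖ + betaPt lam))) :=
    ((tendsto_pow_atTop_nhds_zero_of_lt_one (by norm_num) (by norm_num)).const_mul _).add_const _
  rw [mul_zero, zero_add] at hlim
  refine ge_of_tendsto hlim ?_
  filter_upwards [(mem_juliaSet_compl_iff.1 hz).eventually_ge_atTop (6 * lam + 6)] with n hn
  have ho := mem_outer_of_large hl hn
  rw [greenFun_eq hl ho]
  have h4 := norm_bottcher_sub_le_half hl hn
  have h5 := norm_sub_norm_le (bottcher lam ((quad lam)^[n] z)) ((quad lam)^[n] z)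
  have h6 := norm_iterate_add_le hl z n
  have h7 : ‖bottcher lam ((quad lam)^[n] z)‖ ≤ 2 * (‖z‖ + betaPt lam) ^ 2 ^ n := by linarith
  have h8 := Real.log_le_log (by linarith [one_lt_norm_bottcher hl ho]) h7
  have h9 : (‖z‖ + betaPt lam) ^ 2 ^ n ≠ 0 := by
    have := norm_nonneg z
    positivity
  rw [Real.log_mul (by norm_num) h9, Real.log_pow] at h8
  rw [div_le_iff₀ (by positivity), one_div, inv_pow, add_mul, mul_assoc,
    inv_mul_cancel₀ (by positivity)]
  push_cast at h8
  linarith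

lemma norm_bottcher_le (hl : 2 + Real.sqrt 2 < lam) {z : ℂ} (hz : z ∈ outer lam) :
    ‖bottcher lam z‖ ≤ ‖z‖ + betaPt lam := by
  have h2 := two_lt_betaPt hl
  have := greenFun_le hl (outer_subset_compl hl hz)
  rw [greenFun_eq_of_mem_outer hl hz] at this
  exact (Real.log_le_log_iff (by linarith [one_lt_norm_bottcher hl hz])
    (by linarith [norm_nonneg z])).1 this

lemma harmonicOnNhd_greenFun (hl : 2 + Real.sqrt 2 < lam) :
    InnerProductSpace.HarmonicOnNhd (greenFun lam) (juliaSet lam)ᶜ := by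
  intro z hz
  obtain ⟨n, hn⟩ := (mem_compl_iff_exists hl).1 hz
  have hopen : ∀ᶠ w in 𝓝 z, (quad lam)^[n] w ∈ outer lam :=
    (continuous_quad.iterate n).continuousAt (isOpen_outer.mem_nhds hn)
  have ha : AnalyticAt ℂ (fun w => bottcher lam ((quad lam)^[n] w)) z :=
    (analyticAt_bottcher hl hn).comp ((differentiable_quad_iterate n).analyticAt z)
  have hh := (ha.harmonicAt_log_norm (bottcher_ne_zero hl hn)).const_smul (c := (2 ^ n : ℝ)⁻¹)
  refine (InnerProductSpace.harmonicAt_congr_nhds ?_).1 hh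
  filter_upwards [hopen] with w hw
  rw [greenFun_eq hl hw, div_eq_inv_mul]
  simp

lemma tendsto_greenFun_boundary (hl : 2 + Real.sqrt 2 < lam) {ζ : ℂ} (hζ : ζ ∈ juliaSet lam) :
    Tendsto (greenFun lam) (𝓝[(juliaSet lam)ᶜ] ζ) (𝓝 0) := by
  have h2 := two_lt_betaPt hl
  set M := Real.log (2 * betaPt lam + 1) with hM
  rw [Metric.tendsto_nhds]
  intro ε hε
  obtain ⟨n, hn⟩ := pow_unbounded_of_one_lt (M / ε) (show (1 : ℝ) < 2 by norm_num)
  have hev : ∀ᶠ z in 𝓝 ζ, ‖(quad lam)^[n] z‖ < betaPt lam + 1 :=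
    ((continuous_quad.iterate n).norm.tendsto ζ).eventually_lt_const
      (by linarith [norm_iterate_le_of_mem_juliaSet hl hζ n])
  filter_upwards [nhdsWithin_le_nhds hev, self_mem_nhdsWithin] with z hz hzc
  have hp := greenFun_pos hl hzc
  rw [Real.dist_eq, sub_zero, abs_of_pos hp, greenFun_iterate hl hzc n, div_lt_iff₀ (by positivity)]
  have h1 := greenFun_le hl (iterate_mem_compl hl hzc n)
  have h3 := Real.log_le_log (by linarith [norm_nonneg ((quad lam)^[n] z)])
    (show ‖(quad lam)^[n] z‖ + betaPt lam ≤ 2 * betaPt lam + 1 by linarith)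
  rw [div_lt_iff₀ hε] at hn
  linarith

lemma isGreenFunction_greenFun (hl : 2 + Real.sqrt 2 < lam) :
    IsGreenFunction (juliaSet lam) (greenFun lam) where
  harmonic := harmonicOnNhd_greenFun hl
  pos _ hz := greenFun_pos hl hz
  boundary _ hζ := tendsto_greenFun_boundary hl
    ((isClosed_juliaSet hl).frontier_subset hζ)
  infinity := by
    refine ⟨0, ?_⟩
    have h := (tendsto_bottcher_div hl).norm.log (by simp)
    rw [norm_one, Real.log_one] at h
    refine h.congr' ?_
    filter_upwards [tendsto_norm_cobounded_atTop.eventually_ge_atTop (6 * lam + 6)] with z hz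
    have ho := mem_outer_of_large hl hz
    rw [greenFun_eq_of_mem_outer hl ho, norm_div, Real.log_div
      (norm_ne_zero_iff.2 (bottcher_ne_zero hl ho)) (norm_ne_zero_iff.2 (ne_zero_of_mem_outer hl ho))]

/-- The range of the Böttcher function contains a neighbourhood of infinity: `φ` differs from the
identity by at most `1/2` on a disc of radius `4`. -/
lemma exists_bottcher_eq_of_large (hl : 2 + Real.sqrt 2 < lam) {v : ℂ} (hv : 6 * lam + 10 ≤ ‖v‖) :
    ∃ z ∈ outer lam, bottcher lam z = v := by
  have hball : ∀ w ∈ Metric.closedBall v 4, 6 * lam + 6 ≤ ‖w‖ := by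
    intro w hw
    rw [mem_closedBall_iff_norm, norm_sub_rev] at hw
    have := norm_sub_norm_le v w
    linarith
  have hd : DiffContOnCl ℂ (bottcher lam) (Metric.ball v 4) :=
    DifferentiableOn.diffContOnCl_ball (U := Metric.closedBall v 4)
      (fun w hw => (differentiableAt_bottcher hl
        (mem_outer_of_large hl (hball w hw))).differentiableWithinAt) subset_rfl
  have hvb := norm_bottcher_sub_le_half hl (hball v (Metric.mem_closedBall_self (by norm_num)))
  have hvo := mem_outer_of_large hl (hball v (Metric.mem_closedBall_self (by norm_num)))
  have hs : ∀ z ∈ Metric.sphere v 4, 3 ≤ ‖bottcher lam z - bottcher lam v‖ := by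
    intro z hz
    have h1 := norm_bottcher_sub_le_half hl (hball z (Metric.sphere_subset_closedBall hz))
    rw [mem_sphere_iff_norm] at hz
    have h2 := norm_sub_norm_le (z - v) ((bottcher lam v - v) - (bottcher lam z - z))
    have h3 := norm_sub_le (bottcher lam v - v) (bottcher lam z - z)
    rw [show z - v - ((bottcher lam v - v) - (bottcher lam z - z))
      = bottcher lam z - bottcher lam v by ring] at h2
    linarith
  have hfreq : ∃ᶠ z in 𝓝 v, bottcher lam z ≠ bottcher lam v := by
    intro hc
    have : bottcher lam =ᶠ[𝓝 v] fun _ => bottcher lam v := by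
      filter_upwards [hc] with z hz using not_not.1 hz
    exact deriv_bottcher_ne_zero hl hvo (by rw [this.deriv_eq]; simp)
  obtain ⟨z, hz, hzv⟩ := hd.ball_subset_image_closedBall (by norm_num) hs hfreq
    (show v ∈ Metric.ball (bottcher lam v) (3 / 2) by
      rw [mem_ball_iff_norm, norm_sub_rev]; linarith)
  exact ⟨z, mem_outer_of_large hl (hball z hz), hzv⟩

lemma isOpen_bottcher_image (hl : 2 + Real.sqrt 2 < lam) : IsOpen (bottcher lam '' outer lam) := by
  rw [isOpen_iff_mem_nhds]
  rintro _ ⟨z, hz, rfl⟩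
  rw [← map_bottcher_nhds hl hz]
  exact image_mem_map (isOpen_outer.mem_nhds hz)

/-- The Green's mapping exists: it is `w ↦ φ⁻¹(1 / w)`. -/
lemma exists_isGreenMapping (hl : 2 + Real.sqrt 2 < lam) :
    ∃ (H : Set ℂ) (T : ℂ → ℂ), IsGreenMapping (juliaSet lam) H T := by
  have h3 := three_lt_lam hl
  set H : Set ℂ := {w | w = 0 ∨ w⁻¹ ∈ bottcher lam '' outer lam} with hH
  set ψ := Function.invFunOn (bottcher lam) (outer lam) with hψ
  have hleft : ∀ z ∈ outer lam, ψ (bottcher lam z) = z := (injOn_bottcher hl).leftInvOn_invFunOn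
  have hmem : ∀ w ∈ H \ {0}, ∃ z ∈ outer lam, bottcher lam z = w⁻¹ := by
    rintro w ⟨hw | hw, hw0⟩
    · exact absurd hw hw0
    · exact hw
  have hball : ∀ w : ℂ, ‖w‖ < (6 * lam + 10)⁻¹ → w ∈ H := by
    intro w hw
    by_cases h0 : w = 0
    · exact Or.inl h0
    · refine Or.inr (exists_bottcher_eq_of_large hl ?_)
      rw [norm_inv]
      exact ((lt_inv_comm₀ (norm_pos_iff.2 h0) (by positivity)).1 hw).le
  have hnhds : H ∈ 𝓝 (0 : ℂ) :=
    Metric.mem_nhds_iff.2 ⟨(6 * lam + 10)⁻¹, by positivity, fun w hw => hball w (by simpa using hw)⟩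
  have hψd : ∀ z ∈ outer lam, DifferentiableAt ℂ ψ (bottcher lam z) := by
    intro z hz
    have hc : ContinuousAt ψ (bottcher lam z) := by
      rw [ContinuousAt, ← map_bottcher_nhds hl hz, tendsto_map'_iff, hleft z hz]
      refine tendsto_id.congr' ?_
      filter_upwards [isOpen_outer.mem_nhds hz] with y hy
      simp [hleft y hy]
    refine (HasDerivAt.of_local_left_inverse hc
      (f := bottcher lam) (f' := deriv (bottcher lam) z) ?_
      (deriv_bottcher_ne_zero hl hz) ?_).differentiableAt
    · rw [hleft z hz]
      exact (differentiableAt_bottcher hl hz).hasDerivAt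
    · filter_upwards [(isOpen_bottcher_image hl).mem_nhds ⟨z, hz, rfl⟩] with v hv
      obtain ⟨y, hy, rfl⟩ := hv
      rw [hleft y hy]
  refine ⟨H, fun w => ψ w⁻¹, ?_, Or.inl rfl, ⟨?_, ?_, ?_⟩, ?_, ⟨greenFun lam,
    isGreenFunction_greenFun hl, ?_⟩, 1, one_pos, ?_⟩
  · rw [isOpen_iff_mem_nhds]
    rintro w hw
    by_cases h0 : w = 0
    · rwa [h0]
    · have h1 := hw.resolve_left h0
      filter_upwards [(continuousAt_inv₀ h0) ((isOpen_bottcher_image hl).mem_nhds h1)] with v hv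
      exact Or.inr hv
  · rw [compl_convexHull_juliaSet hl]
    intro w hw
    obtain ⟨z, hz, hzw⟩ := hmem w hw
    show ψ w⁻¹ ∈ outer lam
    rwa [← hzw, hleft z hz]
  · intro w hw w' hw' h
    obtain ⟨z, hz, hzw⟩ := hmem w hw
    obtain ⟨z', hz', hzw'⟩ := hmem w' hw'
    simp only [← hzw, ← hzw', hleft z hz, hleft z' hz'] at h
    rw [← inv_inj, ← hzw, ← hzw', h]
  · rw [compl_convexHull_juliaSet hl]
    intro z hz
    refine ⟨(bottcher lam z)⁻¹, ⟨Or.inr ⟨z, hz, by simp⟩, ?_⟩, ?_⟩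
    · simpa using bottcher_ne_zero hl hz
    · simp [hleft z hz]
  · intro w hw
    obtain ⟨z, hz, hzw⟩ := hmem w hw
    have := hψd z hz
    rw [hzw] at this
    exact (this.comp w (differentiableAt_inv hw.2)).differentiableWithinAt
  · intro w hw
    obtain ⟨z, hz, hzw⟩ := hmem w hw
    show greenFun lam (ψ w⁻¹) = _
    rw [← hzw, hleft z hz, greenFun_eq_of_mem_outer hl hz, hzw, norm_inv, Real.log_inv]
  · have hH0 : ∀ᶠ w in 𝓝[≠] (0 : ℂ), w ∈ H \ {0} := by
      filter_upwards [nhdsWithin_le_nhds hnhds, self_mem_nhdsWithin] with w hw hw0 using ⟨hw, hw0⟩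
    have hT : Tendsto (fun w => ψ w⁻¹) (𝓝[≠] 0) (cobounded ℂ) := by
      rw [← tendsto_norm_atTop_iff_cobounded]
      have h1 : Tendsto (fun w : ℂ => ‖w⁻¹‖ - betaPt lam) (𝓝[≠] 0) atTop :=
        tendsto_atTop_add_const_right _ _
          (tendsto_norm_cobounded_atTop.comp tendsto_inv₀_nhdsNE_zero)
      refine tendsto_atTop_mono' _ ?_ h1
      filter_upwards [hH0] with w hw
      obtain ⟨z, hz, hzw⟩ := hmem w hw
      rw [← hzw, hleft z hz]
      linarith [norm_bottcher_le hl hz]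
    have := ((tendsto_bottcher_div hl).inv₀ one_ne_zero).comp hT
    rw [inv_one] at this
    rw [Complex.ofReal_one]
    refine this.congr' ?_
    filter_upwards [hH0] with w hw
    obtain ⟨z, hz, hzw⟩ := hmem w hw
    have hw' : w = (bottcher lam z)⁻¹ := by rw [hzw, inv_inv]
    simp only [Function.comp_apply]
    rw [← hzw, hleft z hz, hw', inv_div, div_eq_inv_mul]

end Green

/-! ### The maximum principle and uniqueness of the Green's function -/

section MaximumPrinciple

/-- A harmonic function is constant near a local maximum: locally it is the real part of a
holomorphic `F`, and the maximum modulus principle applies to `exp F`. -/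
lemma eventually_eq_of_isLocalMax_of_harmonicAt {u : ℂ → ℝ} {z : ℂ}
    (hu : InnerProductSpace.HarmonicAt u z) (hmax : IsLocalMax u z) : ∀ᶠ w in 𝓝 z, u w = u z := by
  obtain ⟨r, hr, hball⟩ := Metric.isOpen_iff.1
    (InnerProductSpace.isOpen_setOfPred_harmonicAt u) z hu
  obtain ⟨F, hF, hFu⟩ := InnerProductSpace.HarmonicOnNhd.exists_analyticOnNhd_ball_re_eq
    (f := u) (z := z) (R := r) (fun x hx => hball hx)
  have hb := Metric.ball_mem_nhds z hr
  have hnorm : ∀ w ∈ Metric.ball z r, ‖Complex.exp (F w)‖ = Real.exp (u w) := by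
    intro w hw
    rw [Complex.norm_exp, ← hFu hw]
  have hz := hnorm z (Metric.mem_ball_self hr)
  have h := Complex.norm_eventually_eq_of_isLocalMax (f := fun w => Complex.exp (F w)) (c := z)
    (by filter_upwards [hb] with w hw using (hF w hw).differentiableAt.cexp)
    (by
      filter_upwards [hb, hmax] with w hw hw'
      simp only [Function.comp_apply]
      rw [hnorm w hw, hz]
      exact Real.exp_le_exp.2 hw')
  filter_upwards [h, hb] with w hw hwb
  rw [hnorm w hwb, hz] at hw
  exact Real.exp_injective hw

/-- The maximum principle on the complement of a closed set, for a harmonic function with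
nonpositive boundary values that tends to `-∞` at infinity. -/
lemma harmonic_nonpos {E : Set ℂ} (hE : IsClosed E) {u : ℂ → ℝ}
    (hu : InnerProductSpace.HarmonicOnNhd u Eᶜ)
    (hb : ∀ ζ ∈ frontier E, ∀ ε > 0, ∀ᶠ z in 𝓝[Eᶜ] ζ, u z < ε)
    (hinf : Tendsto u (cobounded ℂ) atBot) : ∀ z ∈ Eᶜ, u z ≤ 0 := by
  -- Positive superlevel sets are compact: they stay away from infinity and from the boundary.
  have hcompact : ∀ δ > 0, IsCompact {z | z ∈ Eᶜ ∧ δ ≤ u z} := by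
    intro δ hδ
    apply Metric.isCompact_of_isClosed_isBounded
    · rw [isClosed_iff_frequently]
      intro z hz
      by_cases hzE : z ∈ E
      · exfalso
        have h1 : ∃ᶠ y in 𝓝[Eᶜ] z, δ ≤ u y := by
          rw [frequently_nhdsWithin_iff]
          exact hz.mono fun y hy => ⟨hy.2, hy.1⟩
        have hzf : z ∈ frontier E := by
          rw [frontier_eq_closure_inter_closure]
          exact ⟨subset_closure hzE, mem_closure_iff_frequently.2 (hz.mono fun y hy => hy.1)⟩
        exact h1 ((hb z hzf δ hδ).mono fun y hy => not_le.2 hy)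
      · refine ⟨hzE, ?_⟩
        have hc : ContinuousAt u z :=
          hu.continuousOn.continuousAt (hE.isOpen_compl.mem_nhds hzE)
        by_contra! hlt
        exact hz ((hc.eventually_lt_const hlt).mono fun y hy hy' => absurd hy'.2 (not_le.2 hy))
    · have h : {z | u z < δ} ∈ cobounded ℂ := hinf.eventually_lt_atBot δ
      rw [← isCobounded_def, ← isBounded_compl_iff] at h
      exact h.subset fun z hz => not_lt.2 hz.2
  by_contra! hc
  obtain ⟨z₀, hz₀, hpos⟩ := hc
  obtain ⟨z₁, hz₁, hmax⟩ := (hcompact _ hpos).exists_isMaxOn ⟨z₀, hz₀, le_rfl⟩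
    (hu.continuousOn.mono fun z hz => hz.1)
  have hmax' : ∀ z ∈ Eᶜ, u z ≤ u z₁ := by
    intro z hz
    by_cases h : u z₀ ≤ u z
    · exact hmax ⟨hz, h⟩
    · exact (not_le.1 h).le.trans hz₁.2
  have hM := hcompact (u z₁) (lt_of_lt_of_le hpos hz₁.2)
  -- The set where the maximum is attained is compact and open in the plane.
  have hopen : IsOpen {z | z ∈ Eᶜ ∧ u z₁ ≤ u z} := by
    rw [isOpen_iff_mem_nhds]
    rintro z ⟨hz, hzu⟩
    have hn := hE.isOpen_compl.mem_nhds hz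
    have := eventually_eq_of_isLocalMax_of_harmonicAt (hu z hz)
      (by filter_upwards [hn] with w hw using (hmax' w hw).trans hzu)
    filter_upwards [this, hn] with w hw hwE using ⟨hwE, hw ▸ hzu⟩
  have huniv := IsClopen.eq_univ ⟨hM.isClosed, hopen⟩ ⟨z₁, hz₁.1, le_rfl⟩
  exact noncompact_univ ℂ (huniv ▸ hM)

lemma IsGreenFunction.tendsto_atTop {E : Set ℂ} {g : ℂ → ℝ} (hg : IsGreenFunction E g) :
    Tendsto g (cobounded ℂ) atTop := by
  obtain ⟨γ, hγ⟩ := hg.infinity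
  have := hγ.add_atTop (Real.tendsto_log_atTop.comp (tendsto_norm_cobounded_atTop (E := ℂ)))
  simpa using this

/-- Uniqueness of the Green's function: `g₁ - (1 + ε) g₂ ≤ 0` by the maximum principle. -/
lemma IsGreenFunction.le {E : Set ℂ} (hE : IsClosed E) {g₁ g₂ : ℂ → ℝ}
    (h₁ : IsGreenFunction E g₁) (h₂ : IsGreenFunction E g₂) {z : ℂ} (hz : z ∈ Eᶜ) :
    g₁ z ≤ g₂ z := by
  have key : ∀ ε > 0, g₁ z ≤ (1 + ε) * g₂ z := by
    intro ε hε
    have hsmul : InnerProductSpace.HarmonicOnNhd ((1 + ε) • g₂) Eᶜ :=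
      h₂.harmonic.const_smul
    have := harmonic_nonpos hE (h₁.harmonic.sub hsmul)
      (fun ζ hζ δ hδ => by
        have h := (h₁.boundary ζ hζ).sub ((h₂.boundary ζ hζ).const_mul (1 + ε))
        rw [mul_zero, sub_zero] at h
        exact h.eventually_lt_const hδ)
      (by
        obtain ⟨γ₁, hγ₁⟩ := h₁.infinity
        obtain ⟨γ₂, hγ₂⟩ := h₂.infinity
        have h := (hγ₁.sub hγ₂).add_atBot
          (tendsto_neg_atTop_atBot.comp (h₂.tendsto_atTop.const_mul_atTop hε))
        refine h.congr fun w => ?_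
        simp
        ring) z hz
    simpa using this
  have hp := h₂.pos z hz
  refine le_of_forall_pos_le_add fun δ hδ => ?_
  have := key (δ / g₂ z) (by positivity)
  rwa [add_mul, one_mul, div_mul_cancel₀ _ hp.ne'] at this

end MaximumPrinciple

/-! ### Rigidity of the Green's mapping -/

section Uniqueness

variable {lam : ℝ} {H : Set ℂ} {T : ℂ → ℂ}

lemma IsGreenMapping.mapsTo (hl : 2 + Real.sqrt 2 < lam)
    (hT : IsGreenMapping (juliaSet lam) H T) {w : ℂ} (hw : w ∈ H \ {0}) : T w ∈ outer lam := by
  rw [← compl_convexHull_juliaSet hl]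
  exact hT.bijOn.mapsTo hw

lemma IsGreenMapping.isOpen_diff {E : Set ℂ} (hT : IsGreenMapping E H T) : IsOpen (H \ {0}) :=
  hT.isOpen.sdiff isClosed_singleton

lemma IsGreenMapping.analyticAt {E : Set ℂ} (hT : IsGreenMapping E H T) {w : ℂ}
    (hw : w ∈ H \ {0}) : AnalyticAt ℂ T w :=
  hT.holomorphic.analyticAt (hT.isOpen_diff.mem_nhds hw)

lemma IsGreenMapping.norm_bottcher (hl : 2 + Real.sqrt 2 < lam)
    (hT : IsGreenMapping (juliaSet lam) H T) {w : ℂ} (hw : w ∈ H \ {0}) :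
    ‖bottcher lam (T w)‖ = ‖w‖⁻¹ := by
  obtain ⟨g, hg, hgT⟩ := hT.green
  have ho := hT.mapsTo hl hw
  have hc := outer_subset_compl hl ho
  have h1 : g (T w) = greenFun lam (T w) :=
    le_antisymm (hg.le (isClosed_juliaSet hl) (isGreenFunction_greenFun hl) hc)
      ((isGreenFunction_greenFun hl).le (isClosed_juliaSet hl) hg hc)
  rw [greenFun_eq_of_mem_outer hl ho, hgT w hw, ← Real.log_inv] at h1
  have hw0 : 0 < ‖w‖ := norm_pos_iff.2 hw.2
  exact (Real.log_injOn_pos (Set.mem_Ioi.2 (inv_pos.2 hw0))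
    (Set.mem_Ioi.2 (by linarith [one_lt_norm_bottcher hl ho])) h1).symm

/-- Any Green's mapping inverts `1 / φ`: the function `w φ(T w)` is unimodular, hence locally
constant, hence constant because `T` is an open bijection onto a connected set, and it tends to
a positive number at `0`. -/
lemma IsGreenMapping.bottcher_eq (hl : 2 + Real.sqrt 2 < lam)
    (hT : IsGreenMapping (juliaSet lam) H T) {w : ℂ} (hw : w ∈ H \ {0}) :
    bottcher lam (T w) = w⁻¹ := by
  have hnorm : ∀ w ∈ H \ {0}, ‖w * bottcher lam (T w)‖ = 1 := by
    intro w hw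
    rw [norm_mul, hT.norm_bottcher hl hw, mul_inv_cancel₀ (norm_ne_zero_iff.2 hw.2)]
  have hloc : ∀ w ∈ H \ {0}, ∀ᶠ v in 𝓝 w,
      v ∈ H \ {0} ∧ v * bottcher lam (T v) = w * bottcher lam (T w) := by
    intro w hw
    have hn := hT.isOpen_diff.mem_nhds hw
    have := Complex.eventually_eq_of_isLocalMax_norm (f := fun v => v * bottcher lam (T v)) (c := w)
      (by
        filter_upwards [hn] with v hv
        exact differentiableAt_id.mul ((differentiableAt_bottcher hl (hT.mapsTo hl hv)).comp v
          (hT.analyticAt hv).differentiableAt))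
      (by
        filter_upwards [hn] with v hv
        simp only [Function.comp_apply, hnorm v hv, hnorm w hw, le_refl])
    filter_upwards [this, hn] with v hv hv' using ⟨hv', hv⟩
  have hopen : ∀ w ∈ H \ {0}, 𝓝 (T w) ≤ map T (𝓝 w) := by
    intro w hw
    refine (hT.analyticAt hw).eventually_constant_or_nhds_le_map_nhds.resolve_left fun hc => ?_
    have h1 : ∀ᶠ v in 𝓝 w, v = w := by
      filter_upwards [hc, hT.isOpen_diff.mem_nhds hw] with v hv hv'
      exact hT.bijOn.injOn hv' hw hv
    have h2 : ∃ᶠ v in 𝓝[≠] w, v = w := (h1.filter_mono nhdsWithin_le_nhds).frequently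
    exact h2 (by filter_upwards [self_mem_nhdsWithin] with v hv using hv)
  have hsurj : ∀ z ∈ outer lam, ∃ w ∈ H \ {0}, T w = z := by
    rw [← compl_convexHull_juliaSet hl]
    exact hT.bijOn.surjOn
  have hconst : ∀ v ∈ H \ {0}, v * bottcher lam (T v) = w * bottcher lam (T w) := by
    intro v hv
    by_contra hne
    -- Values of `w φ(T w)` separate the image of `T` into open pieces.
    have hop : ∀ q : ℂ → Prop,
        IsOpen (T '' {v | v ∈ H \ {0} ∧ q (v * bottcher lam (T v))}) := by
      intro q
      rw [isOpen_iff_mem_nhds]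
      rintro _ ⟨y, ⟨hy, hq⟩, rfl⟩
      refine hopen y hy (image_mem_map ?_)
      filter_upwards [hloc y hy] with x hx
      exact ⟨hx.1, hx.2 ▸ hq⟩
    obtain ⟨z, hz, ⟨a, ⟨ha, ha'⟩, haz⟩, ⟨b, ⟨hb, hb'⟩, hbz⟩⟩ := isPreconnected_outer hl
      _ _ (hop fun x => x = w * bottcher lam (T w)) (hop fun x => x ≠ w * bottcher lam (T w))
      (fun z hz => by
        obtain ⟨y, hy, rfl⟩ := hsurj z hz
        by_cases h : y * bottcher lam (T y) = w * bottcher lam (T w)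
        · exact Or.inl ⟨y, ⟨hy, h⟩, rfl⟩
        · exact Or.inr ⟨y, ⟨hy, h⟩, rfl⟩)
      ⟨T w, hT.mapsTo hl hw, w, ⟨hw, rfl⟩, rfl⟩ ⟨T v, hT.mapsTo hl hv, v, ⟨hv, hne⟩, rfl⟩
    have : a = b := hT.bijOn.injOn ha hb (haz.trans hbz.symm)
    exact hb' (this ▸ ha')
  obtain ⟨c, hc, hlim⟩ := hT.pole
  have hTinf : Tendsto T (𝓝[≠] 0) (cobounded ℂ) := by
    have h1 : Tendsto (fun w : ℂ => w * T w * w⁻¹) (𝓝[≠] 0) (cobounded ℂ) := by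
      rw [← tendsto_norm_atTop_iff_cobounded]
      have := hlim.norm.pos_mul_atTop (by simpa using hc.ne')
        (tendsto_norm_cobounded_atTop.comp (tendsto_inv₀_nhdsNE_zero (α := ℂ)))
      simpa [norm_mul] using this
    refine h1.congr' ?_
    filter_upwards [self_mem_nhdsWithin] with v hv
    have hv' : v ≠ 0 := hv
    field_simp
  have hlim2 := hlim.mul ((tendsto_bottcher_div hl).comp hTinf)
  have hlim3 : Tendsto (fun _ : ℂ => w * bottcher lam (T w)) (𝓝[≠] 0) (𝓝 (c * 1)) := by
    refine hlim2.congr' ?_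
    filter_upwards [nhdsWithin_le_nhds (hT.isOpen.mem_nhds hT.zero_mem), self_mem_nhdsWithin]
      with v hv hv0
    have h0 := ne_zero_of_mem_outer hl (hT.mapsTo hl ⟨hv, hv0⟩)
    rw [← hconst v ⟨hv, hv0⟩, Function.comp_apply]
    field_simp
  have hval := tendsto_nhds_unique hlim3 tendsto_const_nhds
  have h1 := hnorm w hw
  rw [← hval, mul_one, Complex.norm_real, Real.norm_of_nonneg hc.le] at h1
  rw [h1, mul_one, Complex.ofReal_one] at hval
  exact eq_inv_of_mul_eq_one_right hval.symm

lemma IsGreenMapping.mem_of_bottcher_eq (hl : 2 + Real.sqrt 2 < lam)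
    (hT : IsGreenMapping (juliaSet lam) H T) {z w : ℂ} (hz : z ∈ outer lam)
    (h : bottcher lam z = w⁻¹) : w ∈ H \ {0} ∧ T w = z := by
  have hz' := hz
  rw [← compl_convexHull_juliaSet hl] at hz'
  obtain ⟨v, hv, rfl⟩ := hT.bijOn.surjOn hz'
  rw [hT.bottcher_eq hl hv, inv_inj] at h
  exact ⟨h ▸ hv, by rw [h]⟩

/-- The Green's mapping conjugates `w ↦ w²` to `P`. -/
lemma IsGreenMapping.sq_mem (hl : 2 + Real.sqrt 2 < lam)
    (hT : IsGreenMapping (juliaSet lam) H T) {w : ℂ} (hw : w ∈ H \ {0}) :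
    w ^ 2 ∈ H \ {0} ∧ T (w ^ 2) = quad lam (T w) := by
  have ho := hT.mapsTo hl hw
  exact hT.mem_of_bottcher_eq hl (quad_mem_outer hl ho)
    (by rw [bottcher_quad hl ho, hT.bottcher_eq hl hw, inv_pow])

end Uniqueness

/-! ### Binary digits with bounded runs -/

section Digits

/-- The condition defining `boundedRunSet N`: no `N + 2` consecutive digits coincide. -/
def BoundedRuns (N : ℕ) (ε : ℕ → Fin 2) : Prop :=
  ∀ k : ℕ, (∀ j ≤ N, ε (k + j) = ε k) → ε (k + N + 1) ≠ ε (k + N)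

lemma boundedRunSet_eq_image (N : ℕ) :
    boundedRunSet N = Real.ofDigits '' {ε : ℕ → Fin 2 | BoundedRuns N ε} := by
  ext ψ
  have hterm : ∀ ε : ℕ → Fin 2,
      (fun k : ℕ => ((ε k : ℕ) : ℝ) / 2 ^ (k + 1)) = Real.ofDigitsTerm ε := by
    intro ε
    ext k
    simp [Real.ofDigitsTerm, div_eq_mul_inv]
  constructor
  · rintro ⟨ε, hε, hr⟩
    rw [hterm] at hε
    exact ⟨ε, hr, hε.tsum_eq⟩
  · rintro ⟨ε, hr, rfl⟩
    refine ⟨ε, ?_, hr⟩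
    rw [hterm]
    exact Real.summable_ofDigitsTerm.hasSum

lemma isCompact_boundedRunSet (N : ℕ) : IsCompact (boundedRunSet N) := by
  rw [boundedRunSet_eq_image]
  refine IsCompact.image (IsClosed.isCompact ?_) Real.continuous_ofDigits
  have hopen : ∀ a b : ℕ, IsOpen {ε : ℕ → Fin 2 | ε a = ε b} := fun a b =>
    (isClopen_discrete {p : Fin 2 × Fin 2 | p.1 = p.2}).isOpen.preimage
      (f := fun ε : ℕ → Fin 2 => (ε a, ε b)) (by fun_prop)
  have : {ε : ℕ → Fin 2 | BoundedRuns N ε} = ⋂ k, {ε : ℕ → Fin 2 |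
      (∀ j ≤ N, ε (k + j) = ε k) → ε (k + N + 1) ≠ ε (k + N)} := by
    ext ε; simp [BoundedRuns]
  rw [this]
  refine isClosed_iInter fun k => isClosed_imp ?_ (isClosed_compl_iff.2 (hopen _ _))
  have : {ε : ℕ → Fin 2 | ∀ j ≤ N, ε (k + j) = ε k}
      = ⋂ j ∈ Set.Iic N, {ε : ℕ → Fin 2 | ε (k + j) = ε k} := by
    ext ε; simp
  rw [this]
  exact (Set.finite_Iic N).isOpen_biInter fun j _ => hopen _ _

lemma BoundedRuns.exists_eq {N : ℕ} {ε : ℕ → Fin 2} (h : BoundedRuns N ε) (a : Fin 2) :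
    ∃ k, ε k = a := by
  by_contra! hc
  have h2 : ∀ k, ε k = 1 - a := by
    intro k
    have := hc k
    omega
  exact h 0 (fun j _ => by rw [h2, h2]) (by rw [h2, h2])

lemma boundedRunSet_subset_Ioo (N : ℕ) : boundedRunSet N ⊆ Set.Ioo 0 1 := by
  rw [boundedRunSet_eq_image]
  rintro _ ⟨ε, hε, rfl⟩
  constructor
  · obtain ⟨k, hk⟩ := BoundedRuns.exists_eq hε 1
    refine Real.summable_ofDigitsTerm.tsum_pos (fun _ => Real.ofDigitsTerm_nonneg) k ?_
    simp [Real.ofDigitsTerm, hk]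
  · obtain ⟨k, hk⟩ := BoundedRuns.exists_eq hε 0
    have h1 := hasSum_half_pow_succ
    have : Real.ofDigits ε < ∑' k : ℕ, ((1 : ℝ) / 2) ^ (k + 1) := by
      refine Summable.tsum_lt_tsum (i := k) (fun n => ?_) ?_ Real.summable_ofDigitsTerm h1.summable
      · refine Real.ofDigitsTerm_le.trans (le_of_eq ?_)
        norm_num
        rw [one_div, inv_pow]
      · simp [Real.ofDigitsTerm, hk]
    rwa [h1.tsum_eq] at this

lemma boundedRunSet_shift {N : ℕ} {ψ : ℝ} (h : ψ ∈ boundedRunSet N) :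
    ∃ ψ' ∈ boundedRunSet N, 2 * ψ = ψ' ∨ 2 * ψ = ψ' + 1 := by
  rw [boundedRunSet_eq_image] at h ⊢
  obtain ⟨ε, hε, rfl⟩ := h
  refine ⟨_, ⟨fun i => ε (i + 1), fun k hk => ?_, rfl⟩, ?_⟩
  · have := hε (k + 1) (fun j hj => by
      have : ε (k + j + 1) = ε (k + 1) := hk j hj
      rwa [show k + j + 1 = k + 1 + j by ring] at this)
    show ε (k + N + 1 + 1) ≠ ε (k + N + 1)
    rwa [show k + N + 1 = k + 1 + N by ring]
  · have := Real.ofDigits_eq_sum_add_ofDigits ε 1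
    rw [Finset.sum_range_one, Real.ofDigitsTerm] at this
    have h01 : ((ε 0 : ℕ) : ℝ) = 0 ∨ ((ε 0 : ℕ) : ℝ) = 1 := by
      generalize ε 0 = x
      fin_cases x <;> simp
    rcases h01 with h | h
    · left; rw [this, h]; norm_num; ring
    · right; rw [this, h]; norm_num; ring

end Digits

/-! ### The compact set of angles -/

section Angles

/-- The unimodular numbers `±e^{-iπψ}` with `ψ ∈ F_N`. -/
def angleSet (N : ℕ) : Set ℂ :=
  {u | ∃ ψ ∈ boundedRunSet N, u = Complex.exp (-(Complex.I * (Real.pi : ℂ) * (ψ : ℂ))) ∨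
    u = -Complex.exp (-(Complex.I * (Real.pi : ℂ) * (ψ : ℂ)))}

lemma norm_exp_angle (ψ : ℝ) : ‖Complex.exp (-(Complex.I * (Real.pi : ℂ) * (ψ : ℂ)))‖ = 1 := by
  rw [Complex.norm_exp]
  simp

lemma norm_of_mem_angleSet {N : ℕ} {u : ℂ} (hu : u ∈ angleSet N) : ‖u‖ = 1 := by
  obtain ⟨ψ, -, rfl | rfl⟩ := hu
  · exact norm_exp_angle ψ
  · rw [norm_neg]; exact norm_exp_angle ψ

lemma isCompact_angleSet (N : ℕ) : IsCompact (angleSet N) := by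
  have hc : Continuous fun ψ : ℝ => Complex.exp (-(Complex.I * (Real.pi : ℂ) * (ψ : ℂ))) := by
    fun_prop
  have : angleSet N = (fun ψ : ℝ => Complex.exp (-(Complex.I * (Real.pi : ℂ) * (ψ : ℂ)))) ''
      boundedRunSet N ∪ (fun ψ : ℝ => -Complex.exp (-(Complex.I * (Real.pi : ℂ) * (ψ : ℂ)))) ''
      boundedRunSet N := by
    ext u
    simp only [angleSet, Set.mem_ofPred_eq, Set.mem_union, Set.mem_image]
    constructor
    · rintro ⟨ψ, h, rfl | rfl⟩
      · exact Or.inl ⟨ψ, h, rfl⟩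
      · exact Or.inr ⟨ψ, h, rfl⟩
    · rintro (⟨ψ, h, rfl⟩ | ⟨ψ, h, rfl⟩)
      · exact ⟨ψ, h, Or.inl rfl⟩
      · exact ⟨ψ, h, Or.inr rfl⟩
  rw [this]
  exact ((isCompact_boundedRunSet N).image hc).union ((isCompact_boundedRunSet N).image hc.neg)

lemma sq_mem_angleSet {N : ℕ} {u : ℂ} (hu : u ∈ angleSet N) : u ^ 2 ∈ angleSet N := by
  obtain ⟨ψ, hψ, h⟩ := hu
  have hsq : u ^ 2 = Complex.exp (-(Complex.I * (Real.pi : ℂ) * ((2 * ψ : ℝ) : ℂ))) := by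
    have : u ^ 2 = Complex.exp (-(Complex.I * (Real.pi : ℂ) * (ψ : ℂ))) ^ 2 := by
      rcases h with rfl | rfl <;> ring
    rw [this, ← Complex.exp_nat_mul]
    congr 1
    push_cast
    ring
  obtain ⟨ψ', hψ', h' | h'⟩ := boundedRunSet_shift hψ
  · exact ⟨ψ', hψ', Or.inl (by rw [hsq, h'])⟩
  · refine ⟨ψ', hψ', Or.inr ?_⟩
    rw [hsq, h']
    push_cast
    rw [mul_add, mul_one, neg_add, Complex.exp_add, Complex.exp_neg (Complex.I * Real.pi),
      mul_comm Complex.I (Real.pi : ℂ), Complex.exp_pi_mul_I]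
    norm_num

lemma neg_one_notMem_angleSet (N : ℕ) : (-1 : ℂ) ∉ angleSet N := by
  rintro ⟨ψ, hψ, h⟩
  obtain ⟨h0, h1⟩ := boundedRunSet_subset_Ioo N hψ
  have him : (Complex.exp (-(Complex.I * (Real.pi : ℂ) * (ψ : ℂ)))).im = 0 := by
    rcases h with h | h
    · rw [← h]; simp
    · rw [← neg_inj.1 h]; simp
  rw [Complex.exp_im] at him
  have e1 : (-(Complex.I * (Real.pi : ℂ) * (ψ : ℂ))).re = 0 := by simp
  have e2 : (-(Complex.I * (Real.pi : ℂ) * (ψ : ℂ))).im = -(Real.pi * ψ) := by simp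
  rw [e1, e2, Real.exp_zero, one_mul, Real.sin_neg, neg_eq_zero] at him
  have hp := Real.pi_pos
  exact (Real.sin_pos_of_pos_of_lt_pi (by positivity) (by nlinarith)).ne' him

end Angles

/-! ### Radii in the fundamental domain -/

section Radii

variable {lam : ℝ} {H : Set ℂ} {T : ℂ → ℂ}

/-- A point whose square lies in the fundamental domain, off the negative real axis, is itself in
the fundamental domain: one of the two preimages under `P` maps to it. -/
lemma IsGreenMapping.mem_of_sq_mem (hl : 2 + Real.sqrt 2 < lam)
    (hT : IsGreenMapping (juliaSet lam) H T) {w : ℂ} (hw : w ^ 2 ∈ H \ {0})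
    (hneg : ∀ t : ℝ, t < 0 → w ^ 2 ≠ t) : w ∈ H \ {0} := by
  have ho := hT.mapsTo hl hw
  obtain ⟨z, hz⟩ := IsAlgClosed.exists_pow_nat_eq (T (w ^ 2) + lam) two_pos
  have hquad : quad lam z = T (w ^ 2) := by rw [quad, hz]; ring
  have hzo : z ∈ outer lam := by
    refine mem_outer_of_quad_mem_outer hl (hquad ▸ ho) fun him => ?_
    rw [hquad] at him ⊢
    by_contra! hre
    have hlt : (T (w ^ 2)).re < -betaPt lam := by
      rcases ho with h | h
      · exact absurd him h
      · rw [abs_of_nonpos hre] at h; linarith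
    obtain ⟨t, ht, hφ⟩ := bottcher_ofReal_neg hl hlt
    rw [show (((T (w ^ 2)).re : ℝ) : ℂ) = T (w ^ 2) from Complex.ext rfl (by simp [him]),
      hT.bottcher_eq hl hw] at hφ
    refine hneg t⁻¹ (inv_lt_zero.2 ht) ?_
    rw [Complex.ofReal_inv, ← hφ, inv_inv]
  have hsq : bottcher lam z ^ 2 = w⁻¹ ^ 2 := by
    rw [← bottcher_quad hl hzo, hquad, hT.bottcher_eq hl hw, inv_pow]
  rcases sq_eq_sq_iff_eq_or_eq_neg.1 hsq with h | h
  · exact (hT.mem_of_bottcher_eq hl hzo h).1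
  · exact (hT.mem_of_bottcher_eq hl (neg_mem_outer hzo) (by rw [bottcher_neg, h, neg_neg])).1

/-- The radii at angles in `±e^{-iπF_N}` lie in the fundamental domain: by repeated squaring they
are carried towards `0` without meeting the negative real axis. -/
lemma IsGreenMapping.radius_mem (hl : 2 + Real.sqrt 2 < lam)
    (hT : IsGreenMapping (juliaSet lam) H T) {N : ℕ} {u : ℂ} (hu : u ∈ angleSet N) {r : ℝ}
    (hr0 : 0 < r) (hr1 : r < 1) : (r : ℂ) * u ∈ H \ {0} := by
  obtain ⟨δ, hδ, hball⟩ := Metric.isOpen_iff.1 hT.isOpen 0 hT.zero_mem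
  obtain ⟨n, hn⟩ := exists_pow_lt_of_lt_one hδ hr1
  replace hn : r ^ 2 ^ n < δ := lt_of_le_of_lt
    (pow_le_pow_of_le_one hr0.le hr1.le Nat.lt_two_pow_self.le) hn
  induction n generalizing r u with
  | zero =>
    have hnorm : ‖(r : ℂ) * u‖ = r := by
      rw [norm_mul, norm_of_mem_angleSet hu, Complex.norm_real, Real.norm_of_nonneg hr0.le, mul_one]
    refine ⟨hball ?_, ?_⟩
    · rw [mem_ball_zero_iff, hnorm]
      simpa using hn
    · rw [Set.mem_singleton_iff, ← norm_eq_zero, hnorm]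
      exact hr0.ne'
  | succ n ih =>
    have hsq : ((r : ℂ) * u) ^ 2 = ((r ^ 2 : ℝ) : ℂ) * u ^ 2 := by push_cast; ring
    refine hT.mem_of_sq_mem hl ?_ ?_
    · rw [hsq]
      exact ih (sq_mem_angleSet hu) (r := r ^ 2) (by positivity) (by nlinarith)
        (by rwa [← pow_mul, ← pow_succ'])
    · intro t ht h
      rw [hsq] at h
      have hnorm := congrArg norm h
      rw [norm_mul, norm_of_mem_angleSet (sq_mem_angleSet hu), Complex.norm_real, Complex.norm_real,
        Real.norm_of_nonneg (by positivity), Real.norm_of_nonpos ht.le, mul_one] at hnorm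
      have h0 : ((r ^ 2 : ℝ) : ℂ) ≠ 0 := by exact_mod_cast (pow_pos hr0 2).ne'
      have : u ^ 2 = -1 := by
        apply mul_left_cancel₀ h0
        rw [h, hnorm]
        simp
      exact neg_one_notMem_angleSet N (this ▸ sq_mem_angleSet hu)

end Radii

/-! ### Derivative estimates along the radii -/

section Estimates

variable {lam : ℝ} {H : Set ℂ} {T : ℂ → ℂ}

/-- Near the unit circle the Green's mapping takes values of modulus at least some `ρ > 1`, because
the Julia set avoids a disc of radius greater than `1`. -/
lemma IsGreenMapping.exists_norm_ge (hl : 2 + Real.sqrt 2 < lam)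
    (hT : IsGreenMapping (juliaSet lam) H T) :
    ∃ ρ : ℝ, 1 < ρ ∧ ρ < 2 ∧ ∃ r₁ : ℝ, 0 < r₁ ∧ r₁ < 1 ∧ ∀ w ∈ H \ {0}, r₁ ≤ ‖w‖ → ρ ≤ ‖T w‖ := by
  have h1 := one_lt_lam_sub_betaPt hl
  obtain ⟨ρ, hρ1, hρ⟩ := exists_between (show 1 < min 2 (Real.sqrt (lam - betaPt lam)) by
    rw [lt_min_iff]
    exact ⟨by norm_num, Real.lt_sqrt_of_sq_lt (by linarith)⟩)
  obtain ⟨hρ2, hρ3⟩ := lt_min_iff.1 hρ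
  have hsq : ρ ^ 2 < lam - betaPt lam := (Real.lt_sqrt (by linarith)).1 hρ3
  have hsub : Metric.closedBall (0 : ℂ) ρ ⊆ (juliaSet lam)ᶜ := by
    intro z hz hzE
    rw [mem_closedBall_zero_iff] at hz
    have h2 := norm_iterate_le_of_mem_juliaSet hl hzE 1
    rw [Function.iterate_one, quad, norm_sub_rev] at h2
    have h3 := norm_sub_norm_le (lam : ℂ) (z ^ 2)
    rw [norm_pow, Complex.norm_real, Real.norm_of_nonneg (by linarith [two_lt_betaPt hl])] at h3
    have : ‖z‖ ^ 2 ≤ ρ ^ 2 := by gcongr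
    linarith
  obtain ⟨z₀, hz₀, hmin⟩ := (isCompact_closedBall (0 : ℂ) ρ).exists_isMinOn
    ⟨0, Metric.mem_closedBall_self (by linarith)⟩
    ((harmonicOnNhd_greenFun hl).continuousOn.mono hsub)
  have hη := greenFun_pos hl (hsub hz₀)
  obtain ⟨r₁, hr₁, hr₁'⟩ := exists_between (show Real.exp (-greenFun lam z₀) < 1 by
    rw [Real.exp_lt_one_iff]; linarith)
  refine ⟨ρ, hρ1, hρ2, r₁, (Real.exp_pos _).trans hr₁, hr₁', fun w hw hwr => ?_⟩
  by_contra! hlt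
  have h2 : greenFun lam z₀ ≤ greenFun lam (T w) :=
    hmin (mem_closedBall_zero_iff.2 hlt.le)
  rw [greenFun_eq_of_mem_outer hl (hT.mapsTo hl hw), hT.bottcher_eq hl hw, norm_inv,
    Real.log_inv] at h2
  have h3 := Real.log_lt_log (Real.exp_pos _) (hr₁.trans_le hwr)
  rw [Real.log_exp] at h3
  linarith

lemma IsGreenMapping.deriv_eq (hl : 2 + Real.sqrt 2 < lam)
    (hT : IsGreenMapping (juliaSet lam) H T) {w : ℂ} (hw : w ∈ H \ {0}) :
    deriv T w = w * deriv T (w ^ 2) / T w := by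
  have h0 := ne_zero_of_mem_outer hl (hT.mapsTo hl hw)
  have e : (fun v => T (v ^ 2)) =ᶠ[𝓝 w] fun v => T v ^ 2 - lam := by
    filter_upwards [hT.isOpen_diff.mem_nhds hw] with v hv using (hT.sq_mem hl hv).2
  have d1 := (hT.analyticAt (hT.sq_mem hl hw).1).differentiableAt.hasDerivAt.comp w
    (hasDerivAt_pow 2 w)
  have d2 := (((hT.analyticAt hw).differentiableAt.hasDerivAt.pow 2).sub_const
    (lam : ℂ)).congr_of_eventuallyEq e
  have := d1.unique d2
  rw [eq_div_iff h0]
  norm_num at this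
  linear_combination (-1 / 2 : ℂ) * this

lemma IsGreenMapping.deriv_deriv_eq (hl : 2 + Real.sqrt 2 < lam)
    (hT : IsGreenMapping (juliaSet lam) H T) {w : ℂ} (hw : w ∈ H \ {0}) :
    deriv (deriv T) w = (deriv T (w ^ 2) + 2 * w ^ 2 * deriv (deriv T) (w ^ 2)) / T w
      - w * deriv T (w ^ 2) * deriv T w / T w ^ 2 := by
  have h0 := ne_zero_of_mem_outer hl (hT.mapsTo hl hw)
  have e : deriv T =ᶠ[𝓝 w] fun v => v * deriv T (v ^ 2) / T v := by
    filter_upwards [hT.isOpen_diff.mem_nhds hw] with v hv using hT.deriv_eq hl hv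
  have d1 := (hT.analyticAt (hT.sq_mem hl hw).1).deriv.differentiableAt.hasDerivAt.comp w
    (hasDerivAt_pow 2 w)
  have d2 := ((hasDerivAt_id w).mul d1).div (hT.analyticAt hw).differentiableAt.hasDerivAt h0
  have d3 : deriv (deriv T) w = _ := (d2.congr_of_eventuallyEq e).deriv
  rw [d3]
  simp only [id, Function.comp_apply, Pi.mul_apply]
  field_simp
  norm_num
  ring

/-- One step of the recursion that carries bounds for `T'` and `T''` from `w²` to `w`: since
`|T w| ≥ ρ`, the first derivative gains a factor `1 / ρ`, and the second loses only `2 / ρ < 2`. -/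
lemma IsGreenMapping.norm_deriv_step (hl : 2 + Real.sqrt 2 < lam)
    (hT : IsGreenMapping (juliaSet lam) H T) {ρ : ℝ} (hρ : 1 < ρ) {w : ℂ} (hw : w ∈ H \ {0})
    (hw1 : ‖w‖ ≤ 1) (hTw : ρ ≤ ‖T w‖) {A B : ℝ} (hA : ‖deriv T (w ^ 2)‖ ≤ A)
    (hB : ‖deriv (deriv T) (w ^ 2)‖ ≤ B) :
    ‖deriv T w‖ ≤ A / ρ ∧ ‖deriv (deriv T) w‖ ≤ 2 / ρ * B + (1 + A) * A := by
  have hA0 : 0 ≤ A := (norm_nonneg _).trans hA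
  have hB0 : 0 ≤ B := (norm_nonneg _).trans hB
  have hρ0 : 0 < ρ := by linarith
  have h1 : ‖deriv T w‖ ≤ A / ρ := by
    rw [hT.deriv_eq hl hw, norm_div, norm_mul]
    calc ‖w‖ * ‖deriv T (w ^ 2)‖ / ‖T w‖ ≤ 1 * A / ρ := by gcongr
      _ = A / ρ := by rw [one_mul]
  refine ⟨h1, ?_⟩
  have hAρ : A / ρ ≤ A := div_le_self hA0 hρ.le
  have h2 : ‖(deriv T (w ^ 2) + 2 * w ^ 2 * deriv (deriv T) (w ^ 2)) / T w‖ ≤ A + 2 / ρ * B := by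
    rw [norm_div]
    have h3 : ‖deriv T (w ^ 2) + 2 * w ^ 2 * deriv (deriv T) (w ^ 2)‖ ≤ A + 2 * 1 ^ 2 * B := by
      refine (norm_add_le _ _).trans ?_
      rw [norm_mul, norm_mul, norm_pow, Complex.norm_ofNat]
      gcongr
    calc _ ≤ (A + 2 * 1 ^ 2 * B) / ρ := by gcongr
      _ = A / ρ + 2 / ρ * B := by ring
      _ ≤ _ := by gcongr
  have h4 : ‖w * deriv T (w ^ 2) * deriv T w / T w ^ 2‖ ≤ A * A := by
    rw [norm_div, norm_mul, norm_mul, norm_pow]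
    calc _ ≤ 1 * A * A / 1 ^ 2 := by
          gcongr
          · exact h1.trans hAρ
          · exact hρ.le.trans hTw
      _ = A * A := by ring
  rw [hT.deriv_deriv_eq hl hw]
  refine (norm_sub_le _ _).trans ?_
  linarith

/-- The geometric bounds for `T'` and `T''` on the annuli `s_n ≤ |w| ≤ s_{n+1}`, `s_{n+1}² = s_n`. -/
lemma IsGreenMapping.norm_deriv_bounds (hl : 2 + Real.sqrt 2 < lam)
    (hT : IsGreenMapping (juliaSet lam) H T) {ρ : ℝ} (hρ : 1 < ρ) (hρ2 : ρ < 2) {s : ℕ → ℝ}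
    (hs0 : ∀ n, 0 < s n) (hs1 : ∀ n, s n < 1) (hs : ∀ n, s (n + 1) ^ 2 = s n)
    (hge : ∀ w ∈ H \ {0}, s 0 ≤ ‖w‖ → ρ ≤ ‖T w‖) {N : ℕ} {A B : ℝ}
    (hAB : ∀ u ∈ angleSet N, ∀ r ∈ Set.Icc (s 0) (s 1),
      ‖deriv T (r * u)‖ ≤ A ∧ ‖deriv (deriv T) (r * u)‖ ≤ B) (n : ℕ) :
    ∀ u ∈ angleSet N, ∀ r ∈ Set.Icc (s n) (s (n + 1)),
      ‖deriv T (r * u)‖ ≤ A * (1 / ρ) ^ n ∧ ‖deriv (deriv T) (r * u)‖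
        ≤ (B + (1 + A) * A * (2 - 2 * (1 / 2) ^ n)) * (2 / ρ) ^ n := by
  have hmono : Monotone s := monotone_nat_of_le_succ fun n => by
    rw [← hs n]
    nlinarith [hs0 (n + 1), hs1 (n + 1)]
  have hρ0 : 0 < ρ := by linarith
  induction n with
  | zero => simpa using hAB
  | succ n ih =>
    rintro u hu r ⟨hr1, hr2⟩
    have hr0 : 0 < r := (hs0 _).trans_le hr1
    have hrlt : r < 1 := hr2.trans_lt (hs1 _)
    have hw := hT.radius_mem hl hu hr0 hrlt
    have hnorm : ‖(r : ℂ) * u‖ = r := by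
      rw [norm_mul, norm_of_mem_angleSet hu, Complex.norm_real, Real.norm_of_nonneg hr0.le, mul_one]
    have hsq : ((r : ℂ) * u) ^ 2 = ((r ^ 2 : ℝ) : ℂ) * u ^ 2 := by push_cast; ring
    obtain ⟨h1, h2⟩ := ih (u ^ 2) (sq_mem_angleSet hu) (r ^ 2)
      ⟨hs n ▸ pow_le_pow_left₀ (hs0 _).le hr1 2,
        (pow_le_pow_left₀ hr0.le hr2 2).trans_eq (hs (n + 1))⟩
    rw [← hsq] at h1 h2
    have hA : 0 ≤ A := (norm_nonneg _).trans
      (hAB u hu (s 0) ⟨le_rfl, hmono (Nat.zero_le 1)⟩).1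
    have hTw := hge _ hw (by rw [hnorm]; exact (hmono (Nat.zero_le _)).trans hr1)
    obtain ⟨h3, h4⟩ := hT.norm_deriv_step hl hρ hw (by rw [hnorm]; exact hrlt.le) hTw h1 h2
    have hpow : (1 / ρ) ^ n ≤ 1 := pow_le_one₀ (by positivity) (by
      rw [div_le_one hρ0]; exact hρ.le)
    refine ⟨h3.trans (le_of_eq (by ring)), h4.trans ?_⟩
    have h5 : (1 + A * (1 / ρ) ^ n) * (A * (1 / ρ) ^ n) ≤ (1 + A) * A * (1 / ρ) ^ n := by
      have : A * (1 / ρ) ^ n ≤ A * 1 := by gcongr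
      have hp : 0 ≤ A * (1 / ρ) ^ n := by positivity
      nlinarith
    -- The source term `ρ^{-n}` is smaller than `(2 / ρ)^{n+1}` by the summable factor `2^{-n}`.
    have h6 : (1 / ρ) ^ n ≤ (1 / 2) ^ n * (2 / ρ) ^ (n + 1) := by
      rw [pow_succ, ← mul_assoc, ← mul_pow, show (1 / 2 : ℝ) * (2 / ρ) = 1 / ρ by ring]
      have : 1 ≤ 2 / ρ := by rw [le_div_iff₀ hρ0]; linarith
      have hp : 0 ≤ (1 / ρ) ^ n := by positivity
      nlinarith
    have h7 : (1 + A) * A * (1 / ρ) ^ n ≤ (1 + A) * A * ((1 / 2) ^ n * (2 / ρ) ^ (n + 1)) := by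
      gcongr
    calc _ ≤ 2 / ρ * ((B + (1 + A) * A * (2 - 2 * (1 / 2) ^ n)) * (2 / ρ) ^ n)
          + (1 + A) * A * ((1 / 2) ^ n * (2 / ρ) ^ (n + 1)) := by linarith
      _ = _ := by ring

/-- The bound for the integral of `|T''|` along the radii. The annulus `s_n ≤ |w| ≤ s_{n+1}` has
width `O(2^{-n})` and there `|T''| = O((2 / ρ)^n)`, so that it contributes `O(ρ^{-n})`. -/
lemma IsGreenMapping.exists_integral_bound (hl : 2 + Real.sqrt 2 < lam)
    (hT : IsGreenMapping (juliaSet lam) H T) (N : ℕ) {r₀ : ℝ} (hr₀ : 0 < r₀) :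
    ∃ C : NNReal, ∀ u ∈ angleSet N,
      ∫⁻ r in Set.Ioo r₀ 1, ‖deriv (deriv T) ((r : ℂ) * u)‖ₑ ≤ (C : ENNReal) := by
  obtain ⟨ρ, hρ, hρ2, r₁, hr₁, hr₁', hge⟩ := hT.exists_norm_ge hl
  have hρ0 : 0 < ρ := by linarith
  set s : ℕ → ℝ := fun n => r₁ ^ ((1 / 2 : ℝ) ^ n) with hs_def
  have hs0 : ∀ n, 0 < s n := fun n => Real.rpow_pos_of_pos hr₁ _
  have hs1 : ∀ n, s n < 1 := fun n => Real.rpow_lt_one hr₁.le hr₁' (by positivity)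
  have hs : ∀ n, s (n + 1) ^ 2 = s n := by
    intro n
    simp only [hs_def]
    rw [← Real.rpow_natCast, ← Real.rpow_mul hr₁.le, pow_succ]
    congr 1
    push_cast
    ring
  have hsr : s 0 = r₁ := by simp [hs_def]
  have hmono : Monotone s := monotone_nat_of_le_succ fun n => by
    rw [← hs n]
    nlinarith [hs0 (n + 1), hs1 (n + 1)]
  set ℓ := -Real.log r₁ with hℓ
  have hℓ0 : 0 < ℓ := neg_pos.2 (Real.log_neg hr₁ hr₁')
  have hlen : ∀ n, 1 - s n ≤ ℓ * (1 / 2) ^ n := by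
    intro n
    have := Real.add_one_le_exp (Real.log r₁ * (1 / 2) ^ n)
    rw [← Real.rpow_def_of_pos hr₁] at this
    simp only [hs_def, hℓ]
    linarith
  -- Uniform bounds on the compact set of moduli `[min r₀ r₁, s 1]`.
  have hcompact : IsCompact ((fun p : ℝ × ℂ => (p.1 : ℂ) * p.2) ''
      (Set.Icc (min r₀ r₁) (s 1) ×ˢ angleSet N)) :=
    (isCompact_Icc.prod (isCompact_angleSet N)).image (by fun_prop)
  have hsub : ((fun p : ℝ × ℂ => (p.1 : ℂ) * p.2) ''
      (Set.Icc (min r₀ r₁) (s 1) ×ˢ angleSet N)) ⊆ H \ {0} := by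
    rintro _ ⟨⟨r, u⟩, ⟨hr, hu⟩, rfl⟩
    exact hT.radius_mem hl hu ((lt_min hr₀ hr₁).trans_le hr.1) (hr.2.trans_lt (hs1 1))
  obtain ⟨A, hA⟩ := hcompact.exists_bound_of_continuousOn (f := deriv T)
    (fun w hw => (hT.analyticAt (hsub hw)).deriv.continuousAt.continuousWithinAt)
  obtain ⟨B, hB⟩ := hcompact.exists_bound_of_continuousOn (f := deriv (deriv T))
    (fun w hw => (hT.analyticAt (hsub hw)).deriv.deriv.continuousAt.continuousWithinAt)
  have hAB : ∀ u ∈ angleSet N, ∀ r ∈ Set.Icc (s 0) (s 1),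
      ‖deriv T (r * u)‖ ≤ A ∧ ‖deriv (deriv T) (r * u)‖ ≤ B := by
    intro u hu r hr
    have hmem : (r : ℂ) * u ∈ ((fun p : ℝ × ℂ => (p.1 : ℂ) * p.2) ''
        (Set.Icc (min r₀ r₁) (s 1) ×ˢ angleSet N)) :=
      ⟨(r, u), ⟨⟨(min_le_right _ _).trans (hsr ▸ hr.1), hr.2⟩, hu⟩, rfl⟩
    exact ⟨hA _ hmem, hB _ hmem⟩
  have hbound := fun n => hT.norm_deriv_bounds hl hρ hρ2 hs0 hs1 hs (hsr ▸ hge) hAB n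
  set D := max 0 (B + (1 + A) * A * 2) with hD
  have hD0 : 0 ≤ D := le_max_left _ _
  have hsum : Summable fun n : ℕ => D * ℓ * (1 / ρ) ^ n :=
    (summable_geometric_of_lt_one (by positivity) (by rw [div_lt_one hρ0]; exact hρ)).mul_left _
  refine ⟨(ENNReal.ofReal B * ENNReal.ofReal (s 1 - min r₀ r₁)
    + ENNReal.ofReal (∑' n : ℕ, D * ℓ * (1 / ρ) ^ n)).toNNReal, fun u hu => ?_⟩
  rw [ENNReal.coe_toNNReal (ENNReal.add_ne_top.2
    ⟨ENNReal.mul_ne_top ENNReal.ofReal_ne_top ENNReal.ofReal_ne_top, ENNReal.ofReal_ne_top⟩)]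
  have hA0 : 0 ≤ A := (norm_nonneg _).trans
    (hAB u hu (s 0) ⟨le_rfl, hmono (Nat.zero_le 1)⟩).1
  have hcover : Set.Ioo r₀ 1 ⊆ Set.Icc (min r₀ r₁) (s 1) ∪ ⋃ n, Set.Icc (s n) (s (n + 1)) := by
    rintro r ⟨hr, hr'⟩
    by_cases hrs : r ≤ s 1
    · exact Or.inl ⟨(min_le_left _ _).trans hr.le, hrs⟩
    · right
      have hex : ∃ n, r ≤ s n := by
        obtain ⟨n, hn⟩ := exists_pow_lt_of_lt_one (show 0 < (1 - r) / ℓ by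
          apply div_pos _ hℓ0; linarith) (show (1 / 2 : ℝ) < 1 by norm_num)
        refine ⟨n, ?_⟩
        rw [lt_div_iff₀ hℓ0] at hn
        linarith [hlen n]
      classical
      have hspec := Nat.find_spec hex
      obtain ⟨m, hm⟩ : ∃ m, Nat.find hex = m + 1 := by
        refine Nat.exists_eq_succ_of_ne_zero fun h0 => hrs ?_
        rw [h0] at hspec
        exact hspec.trans (hmono (Nat.zero_le 1))
      refine Set.mem_iUnion.2 ⟨m, ?_, hm ▸ hspec⟩
      exact (not_le.1 (Nat.find_min hex (m := m) (by omega))).le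
  refine (MeasureTheory.lintegral_mono_set hcover).trans
    ((MeasureTheory.lintegral_union_le _ _ _).trans (add_le_add ?_ ?_))
  · calc _ ≤ ∫⁻ _ in Set.Icc (min r₀ r₁) (s 1), ENNReal.ofReal B := by
          refine MeasureTheory.setLIntegral_mono' measurableSet_Icc fun r hr => ?_
          rw [← ofReal_norm]
          exact ENNReal.ofReal_le_ofReal (hB _ ⟨(r, u), ⟨hr, hu⟩, rfl⟩)
      _ = _ := by rw [MeasureTheory.setLIntegral_const, Real.volume_Icc]
  · refine (MeasureTheory.lintegral_iUnion_le _ _).trans ?_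
    rw [ENNReal.ofReal_tsum_of_nonneg (fun n => by positivity) hsum]
    refine ENNReal.tsum_le_tsum fun n => ?_
    calc _ ≤ ∫⁻ _ in Set.Icc (s n) (s (n + 1)), ENNReal.ofReal (D * (2 / ρ) ^ n) := by
          refine MeasureTheory.setLIntegral_mono' measurableSet_Icc fun r hr => ?_
          rw [← ofReal_norm]
          refine ENNReal.ofReal_le_ofReal ((hbound n u hu r hr).2.trans ?_)
          gcongr
          refine le_trans ?_ (le_max_right _ _)
          have : (0 : ℝ) ≤ (1 / 2) ^ n := by positivity
          gcongr
          linarith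
      _ = ENNReal.ofReal (D * (2 / ρ) ^ n * (s (n + 1) - s n)) := by
          rw [MeasureTheory.setLIntegral_const, Real.volume_Icc,
            ← ENNReal.ofReal_mul (by positivity)]
      _ ≤ _ := by
          refine ENNReal.ofReal_le_ofReal ?_
          have h1 : s (n + 1) - s n ≤ ℓ * (1 / 2) ^ n := by linarith [hlen n, hs1 (n + 1)]
          calc D * (2 / ρ) ^ n * (s (n + 1) - s n)
              ≤ D * (2 / ρ) ^ n * (ℓ * (1 / 2) ^ n) := by gcongr
            _ = D * ℓ * (2 / ρ * (1 / 2)) ^ n := by rw [mul_pow]; ring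
            _ = D * ℓ * (1 / ρ) ^ n := by rw [show 2 / ρ * (1 / 2) = 1 / ρ by ring]

end Estimates

/-! ### Hausdorff dimension -/

section Dimension

/-- If two digit sequences first differ at the place `k` and have a common digit `0` at a later
place `m`, then the numbers differ by at least one unit of the place `m`. -/
lemma le_abs_ofDigits_sub {a b : ℕ → Fin 2} {k m : ℕ} (hagree : ∀ i < k, a i = b i)
    (hk : a k ≠ b k) (hkm : k < m) (ha : a m = 0) (hb : b m = 0) :
    ((2 : ℝ) ^ (m + 1))⁻¹ ≤ |Real.ofDigits a - Real.ofDigits b| := by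
  wlog hlt : b k = 0 generalizing a b
  · rw [abs_sub_comm]
    refine this (fun i hi => (hagree i hi).symm) hk.symm hb ha ?_
    omega
  have hak : a k = 1 := by omega
  have key : ∀ {a b : ℕ → Fin 2} {m : ℕ}, a 0 = 1 → b 0 = 0 → 0 < m → b m = 0 →
      ((2 : ℝ) ^ (m + 1))⁻¹ ≤ Real.ofDigits a - Real.ofDigits b := by
    intro a b m ha hb hm hbm
    have h1 : (1 / 2 : ℝ) ≤ Real.ofDigits a := by
      have := Real.summable_ofDigitsTerm.le_tsum 0
        (fun j _ => Real.ofDigitsTerm_nonneg (digits := a))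
      simpa [Real.ofDigitsTerm, ha, Real.ofDigits] using this
    have h2 : 1 / 2 + ((2 : ℝ) ^ (m + 1))⁻¹ ≤ 1 - Real.ofDigits b := by
      have hs := hasSum_half_pow_succ.sub (Real.summable_ofDigitsTerm (digits := b)).hasSum
      have := sum_le_hasSum {0, m} (fun i _ => ?_) hs
      · rw [Finset.sum_pair hm.ne] at this
        simpa [Real.ofDigitsTerm, hb, hbm, Real.ofDigits] using this
      · have h := Real.ofDigitsTerm_le (digits := b) (n := i)
        rw [sub_nonneg]
        refine h.trans (le_of_eq ?_)
        norm_num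
        rw [one_div, inv_pow]
    linarith
  have hsum : ∑ i ∈ Finset.range k, Real.ofDigitsTerm a i
      = ∑ i ∈ Finset.range k, Real.ofDigitsTerm b i :=
    Finset.sum_congr rfl fun i hi => by simp [Real.ofDigitsTerm, hagree i (Finset.mem_range.1 hi)]
  have h := key (a := fun i => a (i + k)) (b := fun i => b (i + k)) (m := m - k)
    (by simpa using hak) (by simpa using hlt) (by omega)
    (by simpa [Nat.sub_add_cancel hkm.le] using hb)
  refine le_trans ?_ (le_abs_self _)
  rw [Real.ofDigits_eq_sum_add_ofDigits a k, Real.ofDigits_eq_sum_add_ofDigits b k, hsum,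
    add_sub_add_left_eq_sub, ← mul_sub]
  calc ((2 : ℝ) ^ (m + 1))⁻¹ = ((2 : ℝ) ^ k)⁻¹ * ((2 : ℝ) ^ (m - k + 1))⁻¹ := by
        rw [← mul_inv, ← pow_add]
        rw [show k + (m - k + 1) = m + 1 by omega]
    _ ≤ _ := by
        rw [Nat.cast_ofNat]
        gcongr

/-- The digit sequence made of blocks `0 1 x … x` of length `N + 2`, whose free places are filled
with the digits of `x`. -/
def blockDigits (N : ℕ) (x : ℕ → Fin 2) (k : ℕ) : Fin 2 :=
  if k % (N + 2) = 0 then 0 else if k % (N + 2) = 1 then 1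
    else x (k / (N + 2) * N + (k % (N + 2) - 2))

lemma exists_add_mod_eq {m c : ℕ} (hc : c < m) (k : ℕ) : ∃ j < m, (k + j) % m = c := by
  have hq := Nat.mod_lt k (by omega : 0 < m)
  have hk := Nat.mod_add_div k m
  rcases le_or_gt (k % m) c with h | h
  · refine ⟨c - k % m, by omega, ?_⟩
    rw [show k + (c - k % m) = c + m * (k / m) by omega, Nat.add_mul_mod_self_left,
      Nat.mod_eq_of_lt hc]
  · refine ⟨c + m - k % m, by omega, ?_⟩
    rw [show k + (c + m - k % m) = c + m * (k / m + 1) by rw [mul_add, mul_one]; omega,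
      Nat.add_mul_mod_self_left, Nat.mod_eq_of_lt hc]

/-- Any `N + 2` consecutive places contain the beginning `0` of a block and its second digit `1`. -/
lemma boundedRuns_blockDigits (N : ℕ) (x : ℕ → Fin 2) : BoundedRuns N (blockDigits N x) := by
  intro k hk heq
  have hall : ∀ j < N + 2, blockDigits N x (k + j) = blockDigits N x k := by
    intro j hj
    rcases Nat.lt_succ_iff_lt_or_eq.1 hj with h | rfl
    · exact hk j (by omega)
    · rw [← add_assoc, heq, hk N le_rfl]
  obtain ⟨i, hi, hi'⟩ := exists_add_mod_eq (show 0 < N + 2 by omega) k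
  obtain ⟨j, hj, hj'⟩ := exists_add_mod_eq (show 1 < N + 2 by omega) k
  have h := (hall i hi).trans (hall j hj).symm
  simp [blockDigits, hi', hj'] at h

/-- The digit `x i` is found at the place `(i / N) (N + 2) + i % N + 2`. -/
lemma blockDigits_place {N : ℕ} (hN : 1 ≤ N) (x : ℕ → Fin 2) (i : ℕ) :
    blockDigits N x (i % N + 2 + (N + 2) * (i / N)) = x i := by
  have hlt := Nat.mod_lt i (by omega : 0 < N)
  have h1 : (i % N + 2 + (N + 2) * (i / N)) % (N + 2) = i % N + 2 := by
    rw [Nat.add_mul_mod_self_left, Nat.mod_eq_of_lt (by omega)]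
  have h2 : (i % N + 2 + (N + 2) * (i / N)) / (N + 2) = i / N := by
    rw [Nat.add_mul_div_left _ _ (by omega), Nat.div_eq_of_lt (by omega), zero_add]
  rw [blockDigits, h1, h2, if_neg (by omega), if_neg (by omega)]
  congr 1
  have := Nat.mod_add_div i N
  rw [mul_comm] at this
  omega

/-- Reading off the free digits is Hölder continuous with exponent `N / (N + 2)`. -/
lemma abs_ofDigits_sub_le_blockDigits {N : ℕ} (hN : 1 ≤ N) (x y : ℕ → Fin 2) :
    |Real.ofDigits x - Real.ofDigits y| ≤ 2 ^ (N + 1) *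
      |Real.ofDigits (blockDigits N x) - Real.ofDigits (blockDigits N y)|
        ^ ((N : ℝ) / (N + 2)) := by
  by_cases hex : ∃ k, blockDigits N x k ≠ blockDigits N y k
  · classical
    -- If the sequences first differ in block `j`, then `x` and `y` agree in the first `j N` digits, and
    -- the next block begins with the common digit `0`.
    set k := Nat.find hex with hk
    have hne := Nat.find_spec hex
    rw [← hk] at hne
    have hagree : ∀ i < k, blockDigits N x i = blockDigits N y i :=
      fun i hi => not_not.1 (Nat.find_min hex hi)
    set j := k / (N + 2) with hj
    have hkdiv := Nat.mod_add_div k (N + 2)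
    have hkmod := Nat.mod_lt k (by omega : 0 < N + 2)
    rw [← hj] at hkdiv
    have hzero : ∀ z, blockDigits N z ((N + 2) * (j + 1)) = 0 := by
      intro z
      rw [blockDigits, Nat.mul_mod_right, if_pos rfl]
    have hlow := le_abs_ofDigits_sub hagree hne
      (show k < (N + 2) * (j + 1) by rw [mul_add]; omega) (hzero x) (hzero y)
    have hup : |Real.ofDigits x - Real.ofDigits y| ≤ ((2 : ℕ) ^ (j * N) : ℝ)⁻¹ := by
      refine Real.abs_ofDigits_sub_ofDigits_le fun i hi => ?_
      rw [← blockDigits_place hN x i, ← blockDigits_place hN y i]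
      apply hagree
      have h1 : i / N + 1 ≤ j := (Nat.div_lt_iff_lt_mul (by omega)).2 hi
      have h2 : (N + 2) * (i / N + 1) ≤ (N + 2) * j := Nat.mul_le_mul_left _ h1
      have := Nat.mod_lt i (by omega : 0 < N)
      rw [mul_add] at h2
      omega
    have hN' : (0 : ℝ) < N + 2 := by positivity
    have hpow : ((2 : ℝ) ^ (j * N + (N + 1)))⁻¹
        ≤ |Real.ofDigits (blockDigits N x) - Real.ofDigits (blockDigits N y)|
          ^ ((N : ℝ) / (N + 2)) := by
      refine le_trans ?_ (Real.rpow_le_rpow (by positivity) hlow (by positivity))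
      rw [← Real.rpow_natCast, ← Real.rpow_natCast, ← Real.rpow_neg two_pos.le,
        ← Real.rpow_neg two_pos.le, ← Real.rpow_mul two_pos.le]
      apply Real.rpow_le_rpow_of_exponent_le one_le_two
      have hfrac : (N : ℝ) / (N + 2) ≤ 1 := by
        rw [div_le_one hN']; linarith
      have : (((N + 2) * (j + 1) + 1 : ℕ) : ℝ) * ((N : ℝ) / (N + 2))
          = (j + 1) * N + (N : ℝ) / (N + 2) := by
        push_cast
        field_simp
      rw [neg_mul, this]
      push_cast
      linarith
    refine hup.trans ?_
    calc ((2 : ℕ) ^ (j * N) : ℝ)⁻¹ = 2 ^ (N + 1) * ((2 : ℝ) ^ (j * N + (N + 1)))⁻¹ := by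
          rw [pow_add _ (j * N), mul_inv, Nat.cast_ofNat]
          field_simp
      _ ≤ _ := by gcongr
  · push Not at hex
    have : x = y := by
      ext1 i
      rw [← blockDigits_place hN x i, hex, blockDigits_place hN y i]
    rw [this, sub_self, abs_zero]
    positivity

/-- The lower bound `N / (N + 2)` for the Hausdorff dimension: a subset of `F_N` is mapped onto
`[0, 1]` by a map that is Hölder continuous with this exponent. -/
lemma le_dimH_boundedRunSet {N : ℕ} (hN : 1 ≤ N) :
    ((N / (N + 2) : NNReal) : ENNReal) ≤ dimH (boundedRunSet N) := by
  set S : Set ℝ := Set.range fun x => Real.ofDigits (blockDigits N x) with hS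
  have hsub : S ⊆ boundedRunSet N := by
    rw [boundedRunSet_eq_image]
    rintro _ ⟨x, rfl⟩
    exact ⟨_, boundedRuns_blockDigits N x, rfl⟩
  refine le_trans ?_ (dimH_mono hsub)
  set ι : (ℕ → Fin 2) → ℝ := fun x => Real.ofDigits (blockDigits N x) with hι
  set f : ℝ → ℝ := fun ψ => Real.ofDigits (Function.invFun ι ψ) with hf
  have hinv : ∀ ψ ∈ S, ι (Function.invFun ι ψ) = ψ := fun ψ hψ => Function.invFun_eq hψ
  have hs0 : (0 : NNReal) < N / (N + 2) := by
    have : (0 : NNReal) < N := by exact_mod_cast hN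
    positivity
  have hholder : HolderOnWith (2 ^ (N + 1)) (N / (N + 2)) f S := by
    intro ψ hψ ψ' hψ'
    have h := abs_ofDigits_sub_le_blockDigits hN (Function.invFun ι ψ) (Function.invFun ι ψ')
    change |f ψ - f ψ'| ≤ 2 ^ (N + 1) * |ι (Function.invFun ι ψ) - ι (Function.invFun ι ψ')|
      ^ ((N : ℝ) / (N + 2)) at h
    rw [hinv ψ hψ, hinv ψ' hψ', ← Real.dist_eq, ← Real.dist_eq] at h
    rw [edist_dist, edist_dist, ENNReal.ofReal_rpow_of_nonneg dist_nonneg (by positivity)]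
    refine (ENNReal.ofReal_le_ofReal h).trans (le_of_eq ?_)
    rw [ENNReal.ofReal_mul (by positivity), ENNReal.ofReal_pow two_pos.le]
    simp
  have himage : Set.Icc (0 : ℝ) 1 ⊆ f '' S := by
    intro t ht
    obtain ⟨x, -, rfl⟩ := Real.ofDigits_SurjOn one_lt_two ht
    refine ⟨ι x, ⟨x, rfl⟩, ?_⟩
    have h := abs_ofDigits_sub_le_blockDigits hN (Function.invFun ι (ι x)) x
    change |f (ι x) - _| ≤ 2 ^ (N + 1) * |ι (Function.invFun ι (ι x)) - ι x|
      ^ ((N : ℝ) / (N + 2)) at h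
    have hN0 : (N : ℝ) / (N + 2) ≠ 0 := by
      have : (0 : ℝ) < N := by exact_mod_cast hN
      positivity
    rw [hinv _ ⟨x, rfl⟩, sub_self, abs_zero, Real.zero_rpow hN0, mul_zero] at h
    exact sub_eq_zero.1 (abs_eq_zero.1 (le_antisymm h (abs_nonneg _)))
  have h1 : dimH (Set.Icc (0 : ℝ) 1) = 1 := by
    have := Real.dimH_of_nonempty_interior (E := ℝ) (s := Set.Icc (0 : ℝ) 1) (by simp)
    simpa using this
  have h2 := (dimH_mono himage).trans (hholder.dimH_image_le hs0)
  rw [h1, ENNReal.le_div_iff_mul_le (Or.inl (by exact_mod_cast hs0.ne')) (Or.inl ENNReal.coe_ne_top),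
    one_mul] at h2
  exact h2

lemma dimH_real_le_one (s : Set ℝ) : dimH s ≤ 1 := by
  have := dimH_mono (Set.subset_univ s)
  rwa [Real.dimH_univ] at this

lemma one_sub_lt_dimH_boundedRunSet {N : ℕ} (hN : 1 ≤ N) :
    1 - 2 / (N : ℝ) < (dimH (boundedRunSet N)).toReal := by
  have h := ENNReal.toReal_mono (ne_top_of_le_ne_top ENNReal.one_ne_top (dimH_real_le_one _))
    (le_dimH_boundedRunSet hN)
  refine lt_of_lt_of_le ?_ h
  have : (0 : ℝ) < N := by exact_mod_cast hN
  rw [ENNReal.coe_toReal, NNReal.coe_div, NNReal.coe_add, NNReal.coe_natCast, NNReal.coe_ofNat,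
    lt_div_iff₀ (by positivity), ← sub_pos]
  field_simp
  ring_nf
  norm_num

lemma dimH_iUnion_boundedRunSet : dimH (⋃ (N : ℕ) (_ : 1 ≤ N), boundedRunSet N) = 1 := by
  refine le_antisymm (dimH_real_le_one _) ?_
  set d := dimH (⋃ (N : ℕ) (_ : 1 ≤ N), boundedRunSet N) with hd
  have hd1 : d ≠ ⊤ := ne_top_of_le_ne_top ENNReal.one_ne_top (dimH_real_le_one _)
  have key : ∀ N : ℕ, 1 ≤ N → 1 - 2 / (N : ℝ) ≤ d.toReal := by
    intro N hN
    refine (one_sub_lt_dimH_boundedRunSet hN).le.trans (ENNReal.toReal_mono hd1 (dimH_mono ?_))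
    exact Set.subset_iUnion₂ (s := fun (N : ℕ) (_ : 1 ≤ N) => boundedRunSet N) N hN
  have hlim : Tendsto (fun N : ℕ => 1 - 2 / (N : ℝ)) atTop (𝓝 (1 - 0)) :=
    (tendsto_const_div_atTop_nhds_zero_nat 2).const_sub 1
  rw [sub_zero] at hlim
  have h1 : (1 : ℝ) ≤ d.toReal :=
    le_of_tendsto hlim ((eventually_ge_atTop 1).mono key)
  rw [← ENNReal.ofReal_toReal hd1]
  exact ENNReal.one_le_ofReal.2 h1

end Dimension

theorem theorem1 :
    (∀ lam : ℝ, 2 + Real.sqrt 2 < lam →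
      (∀ z ∈ juliaSet lam, z.im = 0) ∧
      (∃ (H : Set ℂ) (T : ℂ → ℂ), IsGreenMapping (juliaSet lam) H T) ∧
      ∀ (H : Set ℂ) (T : ℂ → ℂ), IsGreenMapping (juliaSet lam) H T →
        ∀ N : ℕ, 1 ≤ N → ∀ r₀ : ℝ, 0 < r₀ → r₀ < 1 →
          ∃ C : NNReal, ∀ ψ ∈ boundedRunSet N,
            (∀ r : ℝ, 0 < r → r < 1 →
              (r : ℂ) * Complex.exp (-(Complex.I * (Real.pi : ℂ) * (ψ : ℂ))) ∈ H) ∧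
            ∫⁻ r in Set.Ioo r₀ 1,
              ‖iteratedDeriv 2 T
                ((r : ℂ) * Complex.exp (-(Complex.I * (Real.pi : ℂ) * (ψ : ℂ))))‖ₑ
              ≤ (C : ENNReal)) ∧
    (∃ c : ℝ, 0 < c ∧ ∀ N : ℕ, 1 ≤ N →
      1 - c / (N : ℝ) < (dimH (boundedRunSet N)).toReal) ∧
    dimH (⋃ (N : ℕ) (_ : 1 ≤ N), boundedRunSet N) = 1 := by
  refine ⟨fun lam hl => ⟨fun z hz => juliaSet_im hl hz, exists_isGreenMapping hl, ?_⟩,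
    ⟨2, two_pos, fun N hN => one_sub_lt_dimH_boundedRunSet hN⟩, dimH_iUnion_boundedRunSet⟩
  intro H T hT N _ r₀ hr₀ _
  obtain ⟨C, hC⟩ := hT.exists_integral_bound hl N hr₀
  refine ⟨C, fun ψ hψ => ?_⟩
  have hu : Complex.exp (-(Complex.I * (Real.pi : ℂ) * (ψ : ℂ))) ∈ angleSet N :=
    ⟨ψ, hψ, Or.inl rfl⟩
  refine ⟨fun r hr0 hr1 => (hT.radius_mem hl hu hr0 hr1).1, ?_⟩
  simpa only [iteratedDeriv_succ, iteratedDeriv_zero] using hC _ hu
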